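/- Let $K$ be a field, $Q$ a finite quiver and $\Lambda=KQ/I$ a monomial algebra, that is, $I$ is an admissible ideal of the path algebra $KQ$ generated by paths. Paths are written $p=a_1\cdots a_n$ with $t(a_i)=s(a_{i+1})$. A path is called zero in $\Lambda$ if it lies in $I$, and non-zero otherwise. Let $\mathbb F$ be the set of those paths in $I$ that have no proper subpath in $I$. Write $l(p)$ for the length of a path $p$. A pair $(p,q)$ of non-zero, non-trivial paths with $t(p)=s(q)$ is perfect if $pq=0$ in $\Lambda$, every non-zero path $q'$ with $t(p)=s(q')$ and $pq'=0$ has $q$ as a left divisor ($q'=qv$ for some path $v$), and every non-zero path $p'$ with $t(p')=s(q)$ and $p'q=0$ has $p$ as a right divisor ($p'=up$ for some path $u$). A perfect path sequence is a sequence $(p_1,\dots,p_n,p_{n+1}=p_1)$, $n\ge 1$, such that all $(p_i,p_{i+1})$ are perfect pairs; the paths in it are called perfect paths. The underlying cycle associated with the perfect path $p_1$ is the shortest cycle $c$ such that $p_1\cdots p_n=c^{l}$ for some $l>0$. A co-elementary path is a perfect path that is a sink in the Hasse quiver of the set of perfect paths ordered by left divisibility, where an arrow $q\to p$ means that $p$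 is a proper left divisor of $q$ and no perfect path lies strictly between them. For an underlying cycle $c=r_1\cdots r_k$ with all $r_i$ co-elementary (such a factorization exists and is unique), let $|c|=k$ and let $m_c$ be the number of perfect paths that have $r_1$ as a left divisor. Proposition. Suppose that $\Lambda$ is $1$-Iwanaga-Gorenstein, i.e. $\Lambda$ has injective dimension at most $1$ as a left and as a right module over itself. Let $c=a_1\cdots a_n$ be an underlying cycle in $\Lambda$, with arrows $a_i$. Then: 1. each arrow $a_i$ is a perfect path; 2. $c$ has a unique factorization into co-elementary paths, and $|c|=l(c)$; 3. (a) every non-zero non-trivial subpath $p$ of a power $c^m$, $m\geq 1$, such that $pq\in\mathbb F$ for some path $q$ is perfect; and (b) $a_i a_{i+1}\cdots a_{i+m_c}\in\mathbb F$ for all $1\le i\le n$, where the indices of the arrows are taken modulo $n$. -/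

import Mathlib

/-! ### Paths in a quiver -/

/-- `IsWalk u l v`: the list of arrows `l` is composable, starts at `u` and ends at `v`. -/
def IsWalk {V : Type*} [Quiver V] : V → List (Quiver.Total V) → V → Prop
  | u, [], v => u = v
  | u, a :: l, v => a.left = u ∧ IsWalk a.right l v

theorem IsWalk.append {V : Type*} [Quiver V] {u v w : V} {l m : List (Quiver.Total V)}
    (h : IsWalk u l v) (h' : IsWalk v m w) : IsWalk u (l ++ m) w := by
  induction l generalizing u with
  | nil => cases h; exact h'
  | cons a l ih => exact ⟨h.1, ih h.2⟩

/-- A path `a₁ a₂ ⋯ aₙ` in a quiver: a sequence of arrows with `t(aᵢ) = s(aᵢ₊₁)`, together with its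
source and its target (so that there is one trivial path at every vertex). -/
@[ext]
structure QPath (V : Type*) [Quiver V] where
  src : V
  arrows : List (Quiver.Total V)
  tgt : V
  isWalk : IsWalk src arrows tgt

namespace QPath

variable {V : Type*} [Quiver V]

/-- The length of a path. -/
def length (p : QPath V) : ℕ := p.arrows.length

/-- The trivial path at a vertex. -/
def triv (v : V) : QPath V := ⟨v, [], v, rfl⟩

/-- An arrow as a path of length one. -/
def ofArrow (a : Quiver.Total V) : QPath V := ⟨a.left, [a], a.right, rfl, rfl⟩

/-- The concatenation `pq` (first `p`, then `q`) of two paths with `t(p) = s(q)`. -/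
def comp (p q : QPath V) (h : p.tgt = q.src) : QPath V :=
  ⟨p.src, p.arrows ++ q.arrows, q.tgt, p.isWalk.append (h ▸ q.isWalk)⟩

/-- `q` is a subpath of `p`: `p = u q v` for some paths `u`, `v`. -/
def IsSubpath (q p : QPath V) : Prop :=
  ∃ (u v : QPath V) (h₁ : u.tgt = q.src) (h₂ : q.tgt = v.src), p = (u.comp q h₁).comp v h₂

/-- `q` is a left divisor of `p`: `p = q v` for some path `v`. -/
def IsLeftDivisor (q p : QPath V) : Prop :=
  ∃ (v : QPath V) (h : q.tgt = v.src), p = q.comp v h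

/-- `q` is a right divisor of `p`: `p = u q` for some path `u`. -/
def IsRightDivisor (q p : QPath V) : Prop :=
  ∃ (u : QPath V) (h : u.tgt = q.src), p = u.comp q h

/-- `q` is a proper left divisor of `p`. -/
def IsProperLeftDivisor (q p : QPath V) : Prop := q.IsLeftDivisor p ∧ q ≠ p

/-- `IsConcat [p₁, …, pₙ] p`, for `n ≥ 1`: consecutive `pᵢ` are composable and `p = p₁ ⋯ pₙ`. -/
inductive IsConcat : List (QPath V) → QPath V → Prop
  | single (p : QPath V) : IsConcat [p] p
  | cons (p : QPath V) (L : List (QPath V)) (q : QPath V) (h : p.tgt = q.src) :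
      IsConcat L q → IsConcat (p :: L) (p.comp q h)

/-- `w = c ^ m`, for `m ≥ 1`. -/
def IsPower (c : QPath V) (m : ℕ) (w : QPath V) : Prop := IsConcat (List.replicate m c) w

/-- A path whose source and target coincide. -/
def IsCycle (c : QPath V) : Prop := c.src = c.tgt

end QPath

/-! ### The path algebra -/

/-- The path algebra `KQ`: the `K`-vector space with basis the set of all paths. -/
def PathAlgebra (K V : Type*) [Field K] [Quiver V] := QPath V →₀ K

namespace PathAlgebra

variable {K V : Type*} [Field K] [Quiver V]

noncomputable instance : AddCommGroup (PathAlgebra K V) :=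
  inferInstanceAs (AddCommGroup (QPath V →₀ K))

noncomputable instance : Module K (PathAlgebra K V) :=
  inferInstanceAs (Module K (QPath V →₀ K))

/-- The paths form a basis of `KQ`. -/
noncomputable def basis : Module.Basis (QPath V) K (PathAlgebra K V) :=
  ⟨(LinearEquiv.refl K (QPath V →₀ K) : (QPath V →₀ K) ≃ₗ[K] (QPath V →₀ K))⟩

/-- The basis element of `KQ` given by a path. -/
noncomputable def ofPath (p : QPath V) : PathAlgebra K V := basis p

/-- The coefficient of a path in an element of `KQ`. -/
noncomputable def coeff (x : PathAlgebra K V) (p : QPath V) : K := basis.repr x p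

open scoped Classical in
/-- The product of two paths in `KQ`: their concatenation, or zero if they are not composable. -/
noncomputable def pathMul (p q : QPath V) : PathAlgebra K V :=
  if h : p.tgt = q.src then ofPath (p.comp q h) else 0

/-- The bilinear extension of the product of paths. -/
noncomputable def mulHom : PathAlgebra K V →ₗ[K] PathAlgebra K V →ₗ[K] PathAlgebra K V :=
  basis.constr K fun p => basis.constr K fun q => pathMul p q

noncomputable instance : Mul (PathAlgebra K V) := ⟨fun x y => mulHom x y⟩

/-- The unit of `KQ` is the sum of the trivial paths. -/
noncomputable instance [Fintype V] : One (PathAlgebra K V) := ⟨∑ v : V, ofPath (QPath.triv v)⟩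

theorem mul_def (x y : PathAlgebra K V) : x * y = mulHom x y := rfl

theorem one_def [Fintype V] : (1 : PathAlgebra K V) = ∑ v : V, ofPath (QPath.triv v) := rfl

theorem ofPath_mul_ofPath (p q : QPath V) :
    (ofPath p : PathAlgebra K V) * ofPath q = pathMul p q := by
  rw [mul_def, mulHom, ofPath, ofPath, Module.Basis.constr_basis, Module.Basis.constr_basis]

theorem ofPath_mul_of_eq (p q : QPath V) (h : p.tgt = q.src) :
    (ofPath p : PathAlgebra K V) * ofPath q = ofPath (p.comp q h) := by
  rw [ofPath_mul_ofPath, pathMul, dif_pos h]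

theorem ofPath_mul_of_ne (p q : QPath V) (h : ¬ p.tgt = q.src) :
    (ofPath p : PathAlgebra K V) * ofPath q = 0 := by
  rw [ofPath_mul_ofPath, pathMul, dif_neg h]

theorem hom_ext {M : Type*} [AddCommMonoid M] [Module K M] {f g : PathAlgebra K V →ₗ[K] M}
    (h : ∀ p, f (ofPath p) = g (ofPath p)) : f = g :=
  basis.ext h

theorem ofPath_mul_assoc (p q r : QPath V) :
    (ofPath p * ofPath q * ofPath r : PathAlgebra K V) = ofPath p * (ofPath q * ofPath r) := by
  have z1 : ∀ x : PathAlgebra K V, 0 * x = 0 := fun x => by simp [mul_def]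
  have z2 : ∀ x : PathAlgebra K V, x * 0 = 0 := fun x => by simp [mul_def]
  by_cases h1 : p.tgt = q.src
  · by_cases h2 : q.tgt = r.src
    · rw [ofPath_mul_of_eq p q h1, ofPath_mul_of_eq q r h2, ofPath_mul_of_eq (p.comp q h1) r h2,
        ofPath_mul_of_eq p (q.comp r h2) h1]
      simp [QPath.comp]
    · rw [ofPath_mul_of_eq p q h1, ofPath_mul_of_ne q r h2, ofPath_mul_of_ne (p.comp q h1) r h2, z2]
  · by_cases h2 : q.tgt = r.src
    · rw [ofPath_mul_of_ne p q h1, ofPath_mul_of_eq q r h2, ofPath_mul_of_ne p (q.comp r h2) h1, z1]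
    · rw [ofPath_mul_of_ne p q h1, ofPath_mul_of_ne q r h2, z1, z2]

protected theorem mul_assoc (x y z : PathAlgebra K V) : x * y * z = x * (y * z) := by
  let m : PathAlgebra K V →ₗ[K] PathAlgebra K V →ₗ[K] PathAlgebra K V := mulHom
  have h : m.compr₂ m = ((LinearMap.llcomp K (PathAlgebra K V) (PathAlgebra K V)
      (PathAlgebra K V)).flip ∘ₗ m).flip ∘ₗ m := by
    refine hom_ext fun p => hom_ext fun q => hom_ext fun r => ?_
    exact ofPath_mul_assoc p q r
  exact congrArg (fun f => f x y z) h

protected theorem one_mul [Fintype V] (x : PathAlgebra K V) : 1 * x = x := by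
  have h : mulHom (1 : PathAlgebra K V) = LinearMap.id := by
    refine hom_ext fun p => ?_
    rw [one_def, map_sum, LinearMap.sum_apply, Finset.sum_eq_single p.src]
    · exact ofPath_mul_of_eq (QPath.triv p.src) p rfl
    · intro v _ hv
      exact ofPath_mul_of_ne (QPath.triv v) p hv
    · simp
  exact congrArg (fun f => f x) h

protected theorem mul_one [Fintype V] (x : PathAlgebra K V) : x * 1 = x := by
  have h : mulHom.flip (1 : PathAlgebra K V) = LinearMap.id := by
    refine hom_ext fun p => ?_
    rw [one_def, map_sum, LinearMap.sum_apply, Finset.sum_eq_single p.tgt]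
    · refine (ofPath_mul_of_eq p (QPath.triv p.tgt) rfl).trans ?_
      simp [QPath.comp, QPath.triv]
    · intro v _ hv
      exact ofPath_mul_of_ne p (QPath.triv v) fun e => hv e.symm
    · simp
  exact congrArg (fun f => f x) h

noncomputable instance [Fintype V] : Ring (PathAlgebra K V) :=
  { (inferInstance : AddCommGroup (PathAlgebra K V)),
    (inferInstance : Mul (PathAlgebra K V)),
    (inferInstance : One (PathAlgebra K V)) with
    left_distrib := fun x y z => by simp [mul_def]
    right_distrib := fun x y z => by simp [mul_def]
    zero_mul := fun x => by simp [mul_def]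
    mul_zero := fun x => by simp [mul_def]
    mul_assoc := PathAlgebra.mul_assoc
    one_mul := PathAlgebra.one_mul
    mul_one := PathAlgebra.mul_one }

noncomputable instance [Fintype V] : Algebra K (PathAlgebra K V) :=
  Algebra.ofModule (fun r x y => by simp [mul_def]) (fun r x y => by simp [mul_def])

end PathAlgebra

/-! ### Monomial algebras -/

section Monomial

variable {K V : Type*} [Field K] [Quiver V] [Fintype V]

/-- The two-sided ideal `I` of `KQ` is admissible: `R ^ N ⊆ I ⊆ R ^ 2` for some `N ≥ 2`, where `R ^ m`,
the `m`-th power of the arrow ideal, is the span of the paths of length at least `m`. -/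
def IsAdmissible (I : TwoSidedIdeal (PathAlgebra K V)) : Prop :=
  (∃ N : ℕ, 2 ≤ N ∧ ∀ p : QPath V, N ≤ p.length → PathAlgebra.ofPath p ∈ I) ∧
    ∀ x ∈ I, ∀ p : QPath V, x.coeff p ≠ 0 → 2 ≤ p.length

/-- `KQ / I` is a monomial algebra: `I` is admissible and generated by paths. -/
def IsMonomial (I : TwoSidedIdeal (PathAlgebra K V)) : Prop :=
  IsAdmissible I ∧ ∃ S : Set (QPath V), I = TwoSidedIdeal.span (PathAlgebra.ofPath '' S)

/-- The bound quiver algebra `KQ / I`. -/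
abbrev BoundQuiverAlgebra (I : TwoSidedIdeal (PathAlgebra K V)) := I.ringCon.Quotient

/-- `Λ` is `d`-Iwanaga–Gorenstein: `Λ` has injective dimension at most `d` both as a left and as a
right module over itself (right modules are left modules over the opposite ring). -/
def IsIwanagaGorenstein.{u} (d : ℕ) (Λ : Type u) [Ring Λ] : Prop :=
  CategoryTheory.HasInjectiveDimensionLE (ModuleCat.of.{u} Λ Λ) d ∧
    CategoryTheory.HasInjectiveDimensionLE (ModuleCat.of.{u} Λᵐᵒᵖ Λ) d

variable (I : TwoSidedIdeal (PathAlgebra K V))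

/-- The path `p` is zero in `KQ / I`. -/
def IsZeroPath (p : QPath V) : Prop := PathAlgebra.ofPath p ∈ I

/-- The set `𝔽` of the minimal paths among the paths belonging to `I`. -/
def minimalZeroPaths : Set (QPath V) :=
  {p | IsZeroPath I p ∧ ∀ q : QPath V, q.IsSubpath p → IsZeroPath I q → q = p}

/-- `(p, q)` is a perfect pair. -/
structure IsPerfectPair (p q : QPath V) : Prop where
  left_nonzero : ¬ IsZeroPath I p
  right_nonzero : ¬ IsZeroPath I q
  left_nontrivial : 0 < p.length
  right_nontrivial : 0 < q.length
  comp_zero : ∃ h : p.tgt = q.src, IsZeroPath I (p.comp q h)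
  left_divisor : ∀ (q' : QPath V) (h : p.tgt = q'.src), ¬ IsZeroPath I q' →
    IsZeroPath I (p.comp q' h) → q.IsLeftDivisor q'
  right_divisor : ∀ (p' : QPath V) (h : p'.tgt = q.src), ¬ IsZeroPath I p' →
    IsZeroPath I (p'.comp q h) → p.IsRightDivisor p'

/-- `(p₀, …, pₙ₋₁, pₙ = p₀)` is a perfect path sequence (addition in `Fin n` is modulo `n`). -/
def IsPerfectSequence {n : ℕ} [NeZero n] (p : Fin n → QPath V) : Prop :=
  ∀ i, IsPerfectPair I (p i) (p (i + 1))

/-- `p` is a perfect path: it appears in a perfect path sequence. -/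
def IsPerfect (p : QPath V) : Prop :=
  ∃ (n : ℕ) (_ : NeZero n) (s : Fin n → QPath V), IsPerfectSequence I s ∧ ∃ i, s i = p

/-- `c` is the underlying cycle associated with the perfect path `p`: for a perfect path sequence
that starts with `p`, it is the shortest cycle a positive power of which is the product of the
sequence. -/
def IsUnderlyingCycleOf (p c : QPath V) : Prop :=
  ∃ (n : ℕ) (_ : NeZero n) (s : Fin n → QPath V) (w : QPath V), IsPerfectSequence I s ∧ s 0 = p ∧
    QPath.IsConcat (List.ofFn s) w ∧
    (c.IsCycle ∧ ∃ l, 0 < l ∧ c.IsPower l w) ∧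
    ∀ c' : QPath V, (c'.IsCycle ∧ ∃ l, 0 < l ∧ c'.IsPower l w) → c.length ≤ c'.length

/-- `c` is an underlying cycle in `KQ / I`. -/
def IsUnderlyingCycle (c : QPath V) : Prop := ∃ p : QPath V, IsUnderlyingCycleOf I p c

/-- There is an arrow `q ⟶ p` in the Hasse quiver of the set of perfect paths, ordered by left
divisibility. -/
def HasseArrow (q p : QPath V) : Prop :=
  IsPerfect I q ∧ IsPerfect I p ∧ p.IsProperLeftDivisor q ∧
    ¬ ∃ r, IsPerfect I r ∧ p.IsProperLeftDivisor r ∧ r.IsProperLeftDivisor q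

/-- A co-elementary path: a perfect path that is a sink in the Hasse quiver. -/
def IsCoelementary (p : QPath V) : Prop := IsPerfect I p ∧ ∀ q, ¬ HasseArrow I p q

/-- `c = r₁ ⋯ rₙ` with all `rᵢ` co-elementary. -/
def IsCoelementaryFactorization (c : QPath V) (r : List (QPath V)) : Prop :=
  (∀ p ∈ r, IsCoelementary I p) ∧ QPath.IsConcat r c

open scoped Classical in
/-- The list `[r₁, …, rₙ]` of co-elementary paths with `c = r₁ ⋯ rₙ` (the empty list if `c` has no
such factorization). -/
noncomputable def coelementaryFactors (c : QPath V) : List (QPath V) :=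
  if h : ∃ r, IsCoelementaryFactorization I c r then h.choose else []

/-- `|c|`, the number of co-elementary factors of `c`. -/
noncomputable def cycleSize (c : QPath V) : ℕ := (coelementaryFactors I c).length

/-- `m_c`, the number of perfect paths that have the first co-elementary factor of `c` as a left
divisor. -/
noncomputable def perfectCount (c : QPath V) : ℕ :=
  {p : QPath V | IsPerfect I p ∧ ∃ r ∈ (coelementaryFactors I c).head?, r.IsLeftDivisor p}.ncard

end Monomial

/-! The Gorenstein hypothesis enters through a single extension property. If `Λ` has injective
dimension at most one, then Ext¹(Λp, Λ) = Ext²(Λ/Λp, Λ) = 0, so every homomorphism from the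
annihilator of `p` to `Λ` is multiplication by an element of `Λ`, on either side. In a monomial
algebra the annihilator of a path is spanned by paths, so homomorphisms can be prescribed on paths.
Comparing coefficients then turns the existence of a multiplier into a divisibility statement.

This has two consequences. First, any splitting `pq ∈ 𝔽` into non-trivial paths is a perfect pair
(`isPerfectPair_of_comp_mem`): a multiplier realizing the projection onto the paths beginning with
`q` has coefficient 1 at the trivial path at `t(p)` because of `q`, but coefficient 0 because of any
non-zero path killed by `p` and not beginning with `q`; the other side is symmetric. Second, `pq ∈
𝔽` implies `qr ∈ 𝔽` for some `r` (`exists_comp_mem_of_comp_mem`). So on the finite set of non-zero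
non-trivial `p` with some `pq ∈ 𝔽`, passing to `q` is an injective self-map, hence a permutation,
and these paths are exactly the perfect ones (`isPerfect_iff`). Consequently all proper non-trivial
subpaths of members of `𝔽` are perfect, the co-elementary paths are the perfect arrows, and the
perfect paths beginning with such an arrow are the proper non-trivial left divisors of one member of
`𝔽`.

Every position of an underlying cycle starts a member of `𝔽` running along the cycle. Since no
member of `𝔽` properly contains another, the lengths of these members cannot decrease from one
position to the next; being periodic, they are constant, and counting left divisors identifies the
constant as `m_c + 1`. -/

/-! ### Multipliers from injective dimension at most one -/

open CategoryTheory in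
/-- If `M` has injective dimension at most one, then every homomorphism from the annihilator of an
element to `M` is given by an element of `M`. -/
theorem exists_smul_eq_of_hasInjectiveDimensionLE_one.{u} {R M : Type u} [Ring R] [AddCommGroup M]
    [Module R M] (hM : HasInjectiveDimensionLE (ModuleCat.of.{u} R M) 1) (p : R) (φ : R →+ M)
    (hφ : ∀ r x, x * p = 0 → φ (r * x) = r • φ x) :
    ∃ m : M, ∀ x, x * p = 0 → φ x = x • m := by
  let P : InjectivePresentation (ModuleCat.of.{u} R M) := (EnoughInjectives.presentation _).some
  let S : ShortComplex (ModuleCat.{u} R) := ShortComplex.mk P.f (Limits.cokernel.π P.f) (by simp)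
  have hS : S.ShortExact := { exact := ShortComplex.exact_cokernel P.f }
  -- Dimension shifting: the cokernel of an embedding of `M` into an injective module is itself
  -- injective.
  have hC : Injective S.X₃ := injective_iff_hasInjectiveDimensionLT_one.2
    ((hS.hasInjectiveDimensionLT_X₃_iff 0 P.injective).2 hM)
  have hE : Module.Baer R S.X₂ :=
    Module.Baer.iff_injective.2 (Module.injective_module_of_injective_object R S.X₂
      (inj := P.injective))
  have hC' : Module.Baer R S.X₃ :=
    Module.Baer.iff_injective.2 (Module.injective_module_of_injective_object R S.X₃)
  have hexact := (ShortComplex.moduleCat_exact_iff S).1 hS.exact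
  let i : M →ₗ[R] S.X₂ := S.f.hom
  let π : S.X₂ →ₗ[R] S.X₃ := S.g.hom
  have hπi : ∀ m, π (i m) = 0 := fun m => S.moduleCat_zero_apply m
  let A : Ideal R := LinearMap.ker (LinearMap.toSpanSingleton R R p)
  have hA : ∀ x, x ∈ A ↔ x * p = 0 := fun x => by simp [A]
  let f : A →ₗ[R] S.X₂ :=
    { toFun := fun x => i (φ x)
      map_add' := fun x y => by simp
      map_smul' := fun r x => by
        simp only [SetLike.val_smul, smul_eq_mul, RingHom.id_apply]
        rw [hφ r x ((hA x).1 x.2), map_smul] }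
  obtain ⟨g, hg⟩ := hE A f
  have hg' : ∀ x, x * p = 0 → i (φ x) = x • g 1 := fun x hx => by
    rw [← map_smul, smul_eq_mul, mul_one]
    exact (hg x ((hA x).2 hx)).symm
  -- After composition with `π`, the extension `g` kills the annihilator `A`, hence factors through
  -- `R/A ≅ Rp`.
  let k : (R ∙ p) →ₗ[R] S.X₃ :=
    (A.liftQ (LinearMap.toSpanSingleton R S.X₃ (π (g 1))) (fun x hx => by
      rw [LinearMap.mem_ker, LinearMap.toSpanSingleton_apply, ← map_smul,
        ← hg' x ((hA x).1 hx), hπi])).comp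
      (LinearEquiv.ofEq _ _ (LinearMap.span_singleton_eq_range R R p) ≪≫ₗ
        (LinearMap.quotKerEquivRange (LinearMap.toSpanSingleton R R p)).symm).toLinearMap
  have hk : k ⟨p, Submodule.mem_span_singleton_self p⟩ = π (g 1) := by
    have h1 : (LinearMap.quotKerEquivRange (LinearMap.toSpanSingleton R R p)).symm
        (LinearEquiv.ofEq _ _ (LinearMap.span_singleton_eq_range R R p)
          ⟨p, Submodule.mem_span_singleton_self p⟩) = A.mkQ 1 := by
      rw [LinearEquiv.symm_apply_eq]
      ext
      simp [A]
    simp only [k, LinearMap.comp_apply, LinearEquiv.coe_coe, LinearEquiv.trans_apply]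
    rw [h1]
    simp
  -- Extending `k` to `R` and lifting its value at 1 to `d` gives the correction: `g 1 - p • d`
  -- comes from `M`, and `x • (p • d) = 0` whenever `x * p = 0`.
  obtain ⟨k', hk'⟩ := hC' (R ∙ p) k
  obtain ⟨d, hd⟩ := hS.moduleCat_surjective_g (k' 1)
  have hd' : π (g 1 - p • d) = 0 := by
    have h2 := hk' p (Submodule.mem_span_singleton_self p)
    rw [hk] at h2
    have h3 : π d = k' 1 := hd
    rw [map_sub, map_smul, h3, ← map_smul, smul_eq_mul, mul_one, h2, sub_self]
  obtain ⟨m, hm⟩ := hexact _ hd'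
  have hm' : i m = g 1 - p • d := hm
  refine ⟨m, fun x hx => ?_⟩
  have hinj : Function.Injective i := hS.moduleCat_injective_f
  apply hinj
  rw [hg' x hx, map_smul, hm', smul_sub, smul_smul, hx, zero_smul, sub_zero]

/-- The extension property for `R/I`, phrased with representatives in `R`. A homomorphism can thus
be given by an additive map of the path algebra that preserves `I` and is linear modulo `I` only on
the annihilator. -/
theorem exists_mul_of_left_injectiveDimension_le_one.{u} {R : Type u} [Ring R] (I : TwoSidedIdeal R)
    (hG : CategoryTheory.HasInjectiveDimensionLE
      (ModuleCat.of.{u} I.ringCon.Quotient I.ringCon.Quotient) 1)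
    (p : R) (φ : R →+ R) (hφI : ∀ x ∈ I, φ x ∈ I)
    (hφ : ∀ r x, x * p ∈ I → φ (r * x) - r * φ x ∈ I) :
    ∃ m : R, ∀ x, x * p ∈ I → φ x - x * m ∈ I := by
  let π : R →+* I.ringCon.Quotient := I.ringCon.mk'
  have hπ : Function.Surjective π := I.ringCon.mk'_surjective
  have hker : ∀ x, π x = 0 ↔ x ∈ I := fun x => (RingCon.eq I.ringCon (a := x) (b := 0))
  have hker' : ∀ x y, x - y ∈ I → π x = π y := fun x y h => by
    rw [← sub_eq_zero, ← map_sub]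
    exact (hker _).2 h
  let g : {g : R →+ I.ringCon.Quotient // (π : R →+ I.ringCon.Quotient).ker ≤ g.ker} :=
    ⟨(π : R →+ I.ringCon.Quotient).comp φ, fun x hx => (hker _).2 (hφI x ((hker x).1 hx))⟩
  let ψ := AddMonoidHom.liftOfSurjective (π : R →+ I.ringCon.Quotient) hπ g
  have hψ : ∀ x, ψ (π x) = π (φ x) := fun x =>
    AddMonoidHom.liftOfRightInverse_comp_apply (π : R →+ I.ringCon.Quotient) _ _ g x
  obtain ⟨m, hm⟩ := exists_smul_eq_of_hasInjectiveDimensionLE_one hG (π p) ψ (by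
    intro r x hx
    obtain ⟨r, rfl⟩ := hπ r
    obtain ⟨x, rfl⟩ := hπ x
    rw [← map_mul, hker] at hx
    rw [← map_mul, hψ, hψ, smul_eq_mul, ← map_mul]
    exact hker' _ _ (hφ r x hx))
  obtain ⟨m, rfl⟩ := hπ m
  refine ⟨m, fun x hx => ?_⟩
  have h := hm (π x) (by rw [← map_mul]; exact (hker _).2 hx)
  rw [hψ, smul_eq_mul, ← map_mul, ← sub_eq_zero, ← map_sub] at h
  exact (hker _).1 h

theorem exists_mul_of_right_injectiveDimension_le_one.{u} {R : Type u} [Ring R]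
    (I : TwoSidedIdeal R)
    (hG : CategoryTheory.HasInjectiveDimensionLE
      (ModuleCat.of.{u} I.ringCon.Quotientᵐᵒᵖ I.ringCon.Quotient) 1)
    (p : R) (φ : R →+ R) (hφI : ∀ x ∈ I, φ x ∈ I)
    (hφ : ∀ x r, p * x ∈ I → φ (x * r) - φ x * r ∈ I) :
    ∃ m : R, ∀ x, p * x ∈ I → φ x - m * x ∈ I := by
  let π : R →+* I.ringCon.Quotient := I.ringCon.mk'
  have hπ : Function.Surjective π := I.ringCon.mk'_surjective
  have hker : ∀ x, π x = 0 ↔ x ∈ I := fun x => (RingCon.eq I.ringCon (a := x) (b := 0))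
  have hker' : ∀ x y, x - y ∈ I → π x = π y := fun x y h => by
    rw [← sub_eq_zero, ← map_sub]
    exact (hker _).2 h
  let g : {g : R →+ I.ringCon.Quotient // (π : R →+ I.ringCon.Quotient).ker ≤ g.ker} :=
    ⟨(π : R →+ I.ringCon.Quotient).comp φ, fun x hx => (hker _).2 (hφI x ((hker x).1 hx))⟩
  let ψ := AddMonoidHom.liftOfSurjective (π : R →+ I.ringCon.Quotient) hπ g
  have hψ : ∀ x, ψ (π x) = π (φ x) := fun x =>
    AddMonoidHom.liftOfRightInverse_comp_apply (π : R →+ I.ringCon.Quotient) _ _ g x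
  -- Over the opposite ring, the condition `x * p = 0` becomes `p * x = 0`, and the scalar action
  -- becomes right multiplication.
  obtain ⟨m, hm⟩ := exists_smul_eq_of_hasInjectiveDimensionLE_one hG (MulOpposite.op (π p))
    (ψ.comp (MulOpposite.opAddEquiv (α := I.ringCon.Quotient)).symm.toAddMonoidHom) (by
    intro r x hx
    obtain ⟨r, rfl⟩ := MulOpposite.op_surjective r
    obtain ⟨x, rfl⟩ := MulOpposite.op_surjective x
    obtain ⟨r, rfl⟩ := hπ r
    obtain ⟨x, rfl⟩ := hπ x
    have hx' : π (p * x) = 0 := by rw [map_mul]; exact MulOpposite.op_injective hx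
    have h1 : ψ (π x * π r) = ψ (π x) * π r := by
      rw [← map_mul, hψ, hψ, ← map_mul]
      exact hker' _ _ (hφ x r ((hker _).1 hx'))
    exact h1)
  obtain ⟨m, rfl⟩ := hπ m
  refine ⟨m, fun x hx => ?_⟩
  have h : ψ (π x) = π m * π x := hm (MulOpposite.op (π x)) (by
    rw [← MulOpposite.op_mul, ← map_mul, (hker _).2 hx, MulOpposite.op_zero])
  rw [hψ, ← map_mul, ← sub_eq_zero, ← map_sub] at h
  exact (hker _).1 h

/-! ### Cancellation and divisibility of paths -/

section Walks

variable {V : Type*} [Quiver V]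

theorem IsWalk.tgt_unique {u v w : V} {l : List (Quiver.Total V)} (h : IsWalk u l v)
    (h' : IsWalk u l w) : v = w := by
  induction l generalizing u with
  | nil => exact h.symm.trans h'
  | cons a l ih => exact ih h.2 h'.2

theorem IsWalk.src_unique {u v w : V} {l : List (Quiver.Total V)} (h : IsWalk u l w)
    (h' : IsWalk v l w) : u = v := by
  cases l with
  | nil => exact h.trans h'.symm
  | cons a l => exact h.1.symm.trans h'.1

theorem IsWalk.exists_of_append {u w : V} {l m : List (Quiver.Total V)} (h : IsWalk u (l ++ m) w) :
    ∃ v, IsWalk u l v ∧ IsWalk v m w := by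
  induction l generalizing u with
  | nil => exact ⟨u, rfl, h⟩
  | cons a l ih =>
    obtain ⟨v, h1, h2⟩ := ih h.2
    exact ⟨v, ⟨h.1, h1⟩, h2⟩

namespace QPath

theorem eq_of_src {p q : QPath V} (hs : p.src = q.src) (ha : p.arrows = q.arrows) : p = q :=
  QPath.ext hs ha (p.isWalk.tgt_unique (hs ▸ ha ▸ q.isWalk))

theorem eq_of_tgt {p q : QPath V} (ht : p.tgt = q.tgt) (ha : p.arrows = q.arrows) : p = q :=
  QPath.ext (p.isWalk.src_unique (ht ▸ ha ▸ q.isWalk)) ha ht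

theorem src_eq_of_arrows {p q : QPath V} {a : Quiver.Total V} {l m : List (Quiver.Total V)}
    (hp : p.arrows = a :: l) (hq : q.arrows = a :: m) : p.src = q.src := by
  have h1 := p.isWalk
  have h2 := q.isWalk
  rw [hp] at h1
  rw [hq] at h2
  exact h1.1.symm.trans h2.1

/-- The first arrow determines the source. Positive length is needed because an empty list of arrows
does not remember its vertex. -/
theorem src_eq_of_prefix {p q : QPath V} (hp : 0 < p.length) (h : p.arrows <+: q.arrows) :
    p.src = q.src := by
  obtain ⟨t, ht⟩ := h
  obtain ⟨a, l, hl⟩ := List.exists_cons_of_length_pos hp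
  exact src_eq_of_arrows hl (ht.symm.trans (by rw [hl]; rfl))

theorem eq_of_arrows {p q : QPath V} (hp : 0 < p.length) (ha : p.arrows = q.arrows) : p = q :=
  eq_of_src (src_eq_of_prefix hp (ha ▸ List.prefix_rfl)) ha

theorem length_comp (p q : QPath V) (h : p.tgt = q.src) :
    (p.comp q h).length = p.length + q.length := List.length_append

theorem exists_comp {p : QPath V} {l m : List (Quiver.Total V)} (h : p.arrows = l ++ m) :
    ∃ (p₁ p₂ : QPath V) (h' : p₁.tgt = p₂.src), p = p₁.comp p₂ h' ∧ p₁.arrows = l ∧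
      p₂.arrows = m := by
  obtain ⟨v, h1, h2⟩ := (h ▸ p.isWalk : IsWalk p.src (l ++ m) p.tgt).exists_of_append
  exact ⟨⟨p.src, l, v, h1⟩, ⟨v, m, p.tgt, h2⟩, rfl, eq_of_src rfl h, rfl, rfl⟩

theorem comp_left_cancel {p q q' : QPath V} {h : p.tgt = q.src} {h' : p.tgt = q'.src}
    (e : p.comp q h = p.comp q' h') : q = q' :=
  eq_of_src (h.symm.trans h') (List.append_cancel_left (congrArg QPath.arrows e))

theorem comp_right_cancel {p p' q : QPath V} {h : p.tgt = q.src} {h' : p'.tgt = q.src}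
    (e : p.comp q h = p'.comp q h') : p = p' :=
  eq_of_tgt (h.trans h'.symm) (List.append_cancel_right (congrArg QPath.arrows e))

theorem comp_assoc (p q r : QPath V) (h : p.tgt = q.src) (h' : q.tgt = r.src) :
    (p.comp q h).comp r h' = p.comp (q.comp r h') h :=
  eq_of_src rfl (List.append_assoc _ _ _)

theorem isLeftDivisor_comp (p q : QPath V) (h : p.tgt = q.src) : p.IsLeftDivisor (p.comp q h) :=
  ⟨q, h, rfl⟩

theorem isRightDivisor_comp (p q : QPath V) (h : p.tgt = q.src) : q.IsRightDivisor (p.comp q h) :=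
  ⟨p, h, rfl⟩

theorem IsLeftDivisor.isPrefix {p q : QPath V} (h : p.IsLeftDivisor q) : p.arrows <+: q.arrows := by
  obtain ⟨v, h', rfl⟩ := h
  exact List.prefix_append _ _

theorem IsRightDivisor.isSuffix {p q : QPath V} (h : p.IsRightDivisor q) :
    p.arrows <:+ q.arrows := by
  obtain ⟨v, h', rfl⟩ := h
  exact List.suffix_append _ _

theorem isLeftDivisor_of_prefix {p q : QPath V} (hs : p.src = q.src) (h : p.arrows <+: q.arrows) :
    p.IsLeftDivisor q := by
  obtain ⟨t, ht⟩ := h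
  obtain ⟨p₁, p₂, h', rfl, h1, -⟩ := exists_comp ht.symm
  obtain rfl : p = p₁ := eq_of_src hs h1.symm
  exact isLeftDivisor_comp _ _ _

theorem isRightDivisor_of_suffix {p q : QPath V} (hs : p.tgt = q.tgt) (h : p.arrows <:+ q.arrows) :
    p.IsRightDivisor q := by
  obtain ⟨t, ht⟩ := h
  obtain ⟨p₁, p₂, h', rfl, -, h2⟩ := exists_comp ht.symm
  obtain rfl : p = p₂ := eq_of_tgt hs h2.symm
  exact isRightDivisor_comp _ _ _

theorem IsLeftDivisor.antisymm {p q : QPath V} (h : p.IsLeftDivisor q) (h' : q.IsLeftDivisor p) :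
    p = q := by
  obtain ⟨v, h1, rfl⟩ := h
  exact eq_of_src rfl (h'.isPrefix.sublist.antisymm (List.prefix_append _ _).sublist).symm

theorem IsRightDivisor.antisymm {p q : QPath V} (h : p.IsRightDivisor q)
    (h' : q.IsRightDivisor p) : p = q := by
  obtain ⟨v, h1, rfl⟩ := h
  exact eq_of_tgt rfl (h'.isSuffix.sublist.antisymm (List.suffix_append _ _).sublist).symm

theorem IsLeftDivisor.isSubpath {p q : QPath V} (h : p.IsLeftDivisor q) : p.IsSubpath q := by
  obtain ⟨v, h', rfl⟩ := h
  exact ⟨triv p.src, v, rfl, h', eq_of_src rfl rfl⟩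

theorem IsRightDivisor.isSubpath {p q : QPath V} (h : p.IsRightDivisor q) : p.IsSubpath q := by
  obtain ⟨u, h', rfl⟩ := h
  exact ⟨u, triv p.tgt, h', rfl, eq_of_src rfl (List.append_nil _).symm⟩

theorem IsSubpath.isInfix {p q : QPath V} (h : p.IsSubpath q) : p.arrows <:+: q.arrows := by
  obtain ⟨u, v, h₁, h₂, rfl⟩ := h
  exact ⟨u.arrows, v.arrows, rfl⟩

theorem isSubpath_of_infix {p q : QPath V} (hp : 0 < p.length) (h : p.arrows <:+: q.arrows) :
    p.IsSubpath q := by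
  obtain ⟨s, t, hst⟩ := h
  obtain ⟨x, v, h', rfl, h1, -⟩ := exists_comp hst.symm
  obtain ⟨u, y, h'', rfl, -, h2⟩ := exists_comp h1
  obtain rfl : p = y := eq_of_arrows hp h2.symm
  exact ⟨u, v, h'', h', rfl⟩

theorem isSubpath_refl (p : QPath V) : p.IsSubpath p :=
  IsLeftDivisor.isSubpath ⟨triv p.tgt, rfl, eq_of_src rfl (List.append_nil _).symm⟩

theorem isSubpath_trans {p q r : QPath V} (h : p.IsSubpath q) (h' : q.IsSubpath r) :
    p.IsSubpath r := by
  obtain ⟨u, v, h₁, h₂, rfl⟩ := h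
  obtain ⟨u', v', h₃, h₄, rfl⟩ := h'
  exact ⟨u'.comp u h₃, v.comp v' h₄, h₁, h₂, eq_of_src rfl (by simp [comp])⟩

theorem IsSubpath.eq_of_length {p q : QPath V} (h : p.IsSubpath q) (hl : q.length ≤ p.length) :
    p = q := by
  obtain ⟨u, v, h₁, h₂, rfl⟩ := h
  have e : ((u.comp p h₁).comp v h₂).length = u.length + p.length + v.length := by
    change ((u.arrows ++ p.arrows) ++ v.arrows).length = _
    simp [length, add_assoc]
  rw [e] at hl
  have hu : u.arrows = [] := List.length_eq_zero_iff.1 (by unfold length at hl; omega)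
  have hv : v.arrows = [] := List.length_eq_zero_iff.1 (by unfold length at hl; omega)
  have hu' : u.src = u.tgt := by have := u.isWalk; rwa [hu] at this
  exact eq_of_src (h₁.symm.trans hu'.symm) (by simp [comp, hu, hv])

end QPath

end Walks

/-! ### Coefficients of products -/

namespace PathAlgebra

variable {K V : Type*} [Field K] [Quiver V]

theorem coeff_ofPath (p q : QPath V) [Decidable (p = q)] :
    (ofPath p : PathAlgebra K V).coeff q = if p = q then 1 else 0 := by
  classical
  rw [coeff, ofPath, Module.Basis.repr_self, Finsupp.single_apply]

theorem coeff_ofPath_self (p : QPath V) : (ofPath p : PathAlgebra K V).coeff p = 1 := by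
  classical
  rw [coeff_ofPath, if_pos rfl]

theorem coeff_sub (x y : PathAlgebra K V) (p : QPath V) :
    (x - y).coeff p = x.coeff p - y.coeff p := by
  simp [coeff]

/-- Right cancellation of paths: `u` is the only path whose product with `q` is `uq`. -/
theorem coeff_mul_ofPath_comp (x : PathAlgebra K V) (u q : QPath V) (h : u.tgt = q.src) :
    (x * ofPath q).coeff (u.comp q h) = x.coeff u := by
  classical
  have key : basis.coord (u.comp q h) ∘ₗ mulHom.flip (ofPath q : PathAlgebra K V) =
      basis.coord u := by
    refine hom_ext fun z => ?_
    change (ofPath z * ofPath q : PathAlgebra K V).coeff _ = (ofPath z : PathAlgebra K V).coeff u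
    rw [coeff_ofPath]
    by_cases hz : z.tgt = q.src
    · rw [ofPath_mul_of_eq z q hz, coeff_ofPath]
      refine if_congr ⟨fun e => QPath.comp_right_cancel e, ?_⟩ rfl rfl
      rintro rfl
      rfl
    · rw [ofPath_mul_of_ne z q hz, if_neg (by rintro rfl; exact hz h)]
      simp [coeff]
  exact congrArg (fun f => f x) key

theorem coeff_ofPath_mul_comp (x : PathAlgebra K V) (p u : QPath V) (h : p.tgt = u.src) :
    (ofPath p * x).coeff (p.comp u h) = x.coeff u := by
  classical
  have key : basis.coord (p.comp u h) ∘ₗ mulHom (ofPath p : PathAlgebra K V) =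
      basis.coord u := by
    refine hom_ext fun z => ?_
    change (ofPath p * ofPath z : PathAlgebra K V).coeff _ = (ofPath z : PathAlgebra K V).coeff u
    rw [coeff_ofPath]
    by_cases hz : p.tgt = z.src
    · rw [ofPath_mul_of_eq p z hz, coeff_ofPath]
      refine if_congr ⟨fun e => QPath.comp_left_cancel e, ?_⟩ rfl rfl
      rintro rfl
      rfl
    · rw [ofPath_mul_of_ne p z hz, if_neg (by rintro rfl; exact hz h)]
      simp [coeff]
  exact congrArg (fun f => f x) key

theorem isRightDivisor_of_coeff_mul_ne_zero {x : PathAlgebra K V} {q r : QPath V}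
    (h : (x * ofPath q).coeff r ≠ 0) : q.IsRightDivisor r := by
  classical
  by_contra hr
  apply h
  have key : basis.coord r ∘ₗ mulHom.flip (ofPath q : PathAlgebra K V) = 0 := by
    refine hom_ext fun z => ?_
    change (ofPath z * ofPath q : PathAlgebra K V).coeff _ = 0
    by_cases hz : z.tgt = q.src
    · rw [ofPath_mul_of_eq z q hz, coeff_ofPath, if_neg]
      rintro rfl
      exact hr (QPath.isRightDivisor_comp _ _ _)
    · rw [ofPath_mul_of_ne z q hz]
      simp [coeff]
  exact congrArg (fun f => f x) key

theorem coeff_mul_ofPath_self (x : PathAlgebra K V) (q : QPath V) :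
    (x * ofPath q).coeff q = x.coeff (QPath.triv q.src) :=
  coeff_mul_ofPath_comp x (QPath.triv q.src) q rfl

theorem coeff_ofPath_mul_self (x : PathAlgebra K V) (q : QPath V) :
    (ofPath q * x).coeff q = x.coeff (QPath.triv q.tgt) := by
  have e : q.comp (QPath.triv q.tgt) rfl = q := QPath.eq_of_src rfl (List.append_nil _)
  have h := coeff_ofPath_mul_comp x q (QPath.triv q.tgt) rfl
  rwa [e] at h

end PathAlgebra

/-! ### Monomial ideals and multipliers defined on paths -/

section Monomial

open PathAlgebra

variable {K V : Type*} [Field K] [Quiver V] [Fintype V] {I : TwoSidedIdeal (PathAlgebra K V)}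

theorem IsZeroPath.of_isSubpath {p q : QPath V} (hp : IsZeroPath I p) (h : p.IsSubpath q) :
    IsZeroPath I q := by
  obtain ⟨u, v, h₁, h₂, rfl⟩ := h
  unfold IsZeroPath
  rw [← ofPath_mul_of_eq (u.comp p h₁) v h₂, ← ofPath_mul_of_eq u p h₁]
  exact I.mul_mem_right _ _ (I.mul_mem_left _ _ hp)

/-- The span of the zero paths contains the generators and is stable under multiplication by paths.
Membership in `I` can therefore be tested coefficient by coefficient. -/
theorem IsMonomial.mem_iff (hI : IsMonomial I) {x : PathAlgebra K V} :
    x ∈ I ↔ x ∈ Submodule.span K (ofPath '' {p | IsZeroPath I p}) := by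
  constructor
  · intro hx
    obtain ⟨S, hS⟩ := hI.2
    have hmul : ∀ a y : PathAlgebra K V, y ∈ Submodule.span K (ofPath '' {p | IsZeroPath I p}) →
        a * y ∈ Submodule.span K (ofPath '' {p | IsZeroPath I p}) ∧
        y * a ∈ Submodule.span K (ofPath '' {p | IsZeroPath I p}) := by
      intro a y hy
      induction hy using Submodule.span_induction with
      | zero => simp
      | add y z _ _ h1 h2 =>
        rw [mul_add, add_mul]
        exact ⟨add_mem h1.1 h2.1, add_mem h1.2 h2.2⟩
      | smul r y _ h =>
        rw [mul_smul_comm, smul_mul_assoc]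
        exact ⟨Submodule.smul_mem _ _ h.1, Submodule.smul_mem _ _ h.2⟩
      | mem y hy =>
        obtain ⟨p, hp, rfl⟩ := hy
        have ha := (basis (K := K) (V := V)).mem_span a
        induction ha using Submodule.span_induction with
        | zero => simp
        | add y z _ _ h1 h2 =>
          rw [mul_add, add_mul]
          exact ⟨add_mem h1.1 h2.1, add_mem h1.2 h2.2⟩
        | smul r y _ h =>
          rw [mul_smul_comm, smul_mul_assoc]
          exact ⟨Submodule.smul_mem _ _ h.1, Submodule.smul_mem _ _ h.2⟩
        | mem y hy =>
          obtain ⟨a, rfl⟩ := hy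
          change ofPath a * ofPath p ∈ _ ∧ ofPath p * ofPath a ∈ _
          constructor
          · by_cases h : a.tgt = p.src
            · rw [ofPath_mul_of_eq a p h]
              exact Submodule.subset_span
                ⟨_, hp.of_isSubpath (QPath.isRightDivisor_comp _ _ _).isSubpath, rfl⟩
            · rw [ofPath_mul_of_ne a p h]
              exact zero_mem _
          · by_cases h : p.tgt = a.src
            · rw [ofPath_mul_of_eq p a h]
              exact Submodule.subset_span
                ⟨_, hp.of_isSubpath (QPath.isLeftDivisor_comp _ _ _).isSubpath, rfl⟩
            · rw [ofPath_mul_of_ne p a h]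
              exact zero_mem _
    have hSz : ∀ p ∈ S, IsZeroPath I p := fun p hp => by
      unfold IsZeroPath
      rw [hS]
      exact TwoSidedIdeal.subset_span ⟨p, hp, rfl⟩
    rw [hS] at hx
    induction hx using TwoSidedIdeal.span_induction with
    | mem x hx =>
      obtain ⟨p, hp, rfl⟩ := hx
      exact Submodule.subset_span ⟨p, hSz p hp, rfl⟩
    | zero => exact zero_mem _
    | add x y _ _ h1 h2 => exact add_mem h1 h2
    | neg x _ h => exact neg_mem h
    | left_absorb a x _ h => exact (hmul a x h).1
    | right_absorb a x _ h => exact (hmul a x h).2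
  · intro hx
    induction hx using Submodule.span_induction with
    | zero => exact I.zero_mem
    | add y z _ _ h1 h2 => exact I.add_mem h1 h2
    | smul r y _ h =>
      rw [← one_mul y, ← smul_mul_assoc]
      exact I.mul_mem_left _ _ h
    | mem y hy =>
      obtain ⟨p, hp, rfl⟩ := hy
      exact hp

theorem IsMonomial.isZeroPath_of_coeff (hI : IsMonomial I) {x : PathAlgebra K V} (hx : x ∈ I)
    {p : QPath V} (hp : x.coeff p ≠ 0) : IsZeroPath I p := by
  have h := (basis (K := K)).mem_span_image.1 (hI.mem_iff.1 hx)
  exact h (Finsupp.mem_support_iff.2 hp)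

/-- A path `q` that is minimal with `pq = 0` has the following property: if `y` is a path whose right
annihilator contains that of `q`, then the map that sends `qv` to `yv`, and the paths annihilated by
`p` that do not start with `q` to zero, is given by multiplication with an element. -/
theorem exists_left_multiplier (hI : IsMonomial I)
    (hG : IsIwanagaGorenstein 1 (BoundQuiverAlgebra I)) {p q y : QPath V} (h : p.tgt = q.src)
    (hpq : IsZeroPath I (p.comp q h))
    (hmin : ∀ u : QPath V, u.IsLeftDivisor q → ∀ hu : p.tgt = u.src,
      IsZeroPath I (p.comp u hu) → u = q)
    (hy : ∀ (z : QPath V) (hz : q.tgt = z.src), IsZeroPath I (q.comp z hz) →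
      ∀ hz' : y.tgt = z.src, IsZeroPath I (y.comp z hz'))
    (hyq : y.tgt = q.tgt) :
    ∃ x : PathAlgebra K V, ofPath y - x * ofPath q ∈ I ∧
      ∀ (z : QPath V) (hz : p.tgt = z.src), IsZeroPath I (p.comp z hz) →
        ¬ q.IsLeftDivisor z → x * ofPath z ∈ I := by
  classical
  let φ : PathAlgebra K V →ₗ[K] PathAlgebra K V := basis.constr K fun z =>
    if hz : q.IsLeftDivisor z then ofPath y * ofPath hz.choose else 0
  have φ_of : ∀ z, φ (ofPath z) =
      if hz : q.IsLeftDivisor z then ofPath y * ofPath hz.choose else 0 := fun z => by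
    rw [ofPath, Module.Basis.constr_basis]
  have φ_comp : ∀ (v : QPath V) (hv : q.tgt = v.src),
      φ (ofPath (q.comp v hv)) = ofPath y * ofPath v := fun v hv => by
    have hz : q.IsLeftDivisor (q.comp v hv) := QPath.isLeftDivisor_comp _ _ _
    rw [φ_of, dif_pos hz]
    obtain ⟨h1, h2⟩ := hz.choose_spec
    rw [← QPath.comp_left_cancel h2]
  have φ_not : ∀ z : QPath V, ¬ q.IsLeftDivisor z → φ (ofPath z) = 0 := fun z hz => by
    rw [φ_of, dif_neg hz]
  obtain ⟨x, hx⟩ := exists_mul_of_right_injectiveDimension_le_one I hG.2 (ofPath p)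
    φ.toAddMonoidHom (by
      intro x hx
      change φ x ∈ I
      rw [hI.mem_iff] at hx ⊢
      induction hx using Submodule.span_induction with
      | zero => rw [map_zero]; exact zero_mem _
      | add y z _ _ h1 h2 => rw [map_add]; exact add_mem h1 h2
      | smul r y _ h => rw [map_smul]; exact Submodule.smul_mem _ _ h
      | mem x hx =>
        obtain ⟨z, hz, rfl⟩ := hx
        by_cases hqz : q.IsLeftDivisor z
        · obtain ⟨v, hv, rfl⟩ := hqz
          rw [φ_comp, ofPath_mul_of_eq y v (hyq.trans hv)]
          exact Submodule.subset_span ⟨_, hy v hv hz _, rfl⟩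
        · rw [φ_not z hqz]
          exact zero_mem _) (by
      intro x r hx
      change φ (x * r) - φ x * r ∈ I
      -- The right annihilator of `p` is spanned by paths, so linearity need only be checked on a
      -- path `z` with `pz = 0` and a path `r`.
      have hxA : x ∈ Submodule.span K (ofPath ''
          {z : QPath V | ∀ hz : p.tgt = z.src, IsZeroPath I (p.comp z hz)}) := by
        refine basis.mem_span_image.2 fun z hz hz' => ?_
        refine hI.isZeroPath_of_coeff hx ?_
        rw [coeff_ofPath_mul_comp]
        exact Finsupp.mem_support_iff.1 hz
      clear hx
      rw [hI.mem_iff]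
      induction hxA using Submodule.span_induction with
      | zero => simp
      | add y z _ _ h1 h2 =>
        have e : φ ((y + z) * r) - φ (y + z) * r =
          (φ (y * r) - φ y * r) + (φ (z * r) - φ z * r) := by
            rw [add_mul, map_add, map_add, add_mul]; abel
        rw [e]
        exact add_mem h1 h2
      | smul k y _ h =>
        rw [smul_mul_assoc, map_smul, map_smul, smul_mul_assoc, ← smul_sub]
        exact Submodule.smul_mem _ _ h
      | mem x hx =>
        obtain ⟨z, hz, rfl⟩ := hx
        have hr := (basis (K := K) (V := V)).mem_span r
        induction hr using Submodule.span_induction with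
        | zero => simp
        | add s t _ _ h1 h2 =>
          have e : φ (ofPath z * (s + t)) - φ (ofPath z) * (s + t) =
            (φ (ofPath z * s) - φ (ofPath z) * s) + (φ (ofPath z * t) - φ (ofPath z) * t) := by
              rw [mul_add, map_add, mul_add]; abel
          rw [e]
          exact add_mem h1 h2
        | smul k y _ h =>
          rw [mul_smul_comm, map_smul, mul_smul_comm, ← smul_sub]
          exact Submodule.smul_mem _ _ h
        | mem r hr =>
          obtain ⟨r, rfl⟩ := hr
          change φ (ofPath z * ofPath r) - φ (ofPath z) * ofPath r ∈ _
          by_cases hqz : q.IsLeftDivisor z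
          · obtain ⟨v, hv, rfl⟩ := hqz
            rw [φ_comp, mul_assoc]
            by_cases hzr : v.tgt = r.src
            · have h3 := φ_comp (v.comp r hzr) hv
              rw [← QPath.comp_assoc q v r hv hzr] at h3
              rw [ofPath_mul_of_eq (q.comp v hv) r hzr, ofPath_mul_of_eq v r hzr, h3, sub_self]
              exact zero_mem _
            · rw [ofPath_mul_of_ne (q.comp v hv) r hzr, ofPath_mul_of_ne v r hzr]
              simp
          · rw [φ_not z hqz, zero_mul, sub_zero]
            by_cases hzr : z.tgt = r.src
            · rw [ofPath_mul_of_eq z r hzr, φ_not]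
              · exact zero_mem _
              · intro hq
                have hs : q.src = z.src := by
                  obtain ⟨v, hv, e⟩ := hq
                  exact (congrArg QPath.src e).symm
                -- If `zr` begins with `q` but `z` does not, then `z` is a left divisor of `q`
                -- killed by `p`, so minimality forces `z = q`, a contradiction.
                rcases List.prefix_or_prefix_of_prefix hq.isPrefix
                  (List.prefix_append z.arrows r.arrows) with h1 | h1
                · exact hqz (QPath.isLeftDivisor_of_prefix hs h1)
                · have h2 := QPath.isLeftDivisor_of_prefix hs.symm h1
                  have h3 := hmin z h2 (h.trans hs) (hz _)
                  exact hqz (h3 ▸ h2)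
            · rw [ofPath_mul_of_ne z r hzr, map_zero]
              exact zero_mem _)
  refine ⟨x, ?_, fun z hz hz0 hqz => ?_⟩
  · have h1 : φ (ofPath q) - x * ofPath q ∈ I := hx (ofPath q) (by
      rw [ofPath_mul_of_eq p q h]; exact hpq)
    have e : q.comp (QPath.triv q.tgt) rfl = q := QPath.eq_of_src rfl (List.append_nil _)
    have e' : y.comp (QPath.triv q.tgt) hyq = y := QPath.eq_of_src rfl (List.append_nil _)
    have h2 := φ_comp (QPath.triv q.tgt) rfl
    rw [e, ofPath_mul_of_eq y (QPath.triv q.tgt) hyq, e'] at h2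
    rwa [h2] at h1
  · have h1 : φ (ofPath z) - x * ofPath z ∈ I := hx (ofPath z) (by
      rw [ofPath_mul_of_eq p z hz]; exact hz0)
    rw [φ_not z hqz, zero_sub] at h1
    simpa using I.neg_mem h1

/-- If `q` is minimal with `qp = 0`, then the projection onto the paths that end with `q`, restricted
to the paths annihilated by `p`, is given by multiplication with an element. -/
theorem exists_right_multiplier (hI : IsMonomial I)
    (hG : IsIwanagaGorenstein 1 (BoundQuiverAlgebra I)) {p q : QPath V} (h : q.tgt = p.src)
    (hqp : IsZeroPath I (q.comp p h))
    (hmin : ∀ u : QPath V, u.IsRightDivisor q → ∀ hu : u.tgt = p.src,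
      IsZeroPath I (u.comp p hu) → u = q) :
    ∃ x : PathAlgebra K V, ofPath q - ofPath q * x ∈ I ∧
      ∀ (z : QPath V) (hz : z.tgt = p.src), IsZeroPath I (z.comp p hz) →
        ¬ q.IsRightDivisor z → ofPath z * x ∈ I := by
  classical
  let φ : PathAlgebra K V →ₗ[K] PathAlgebra K V := basis.constr K fun z =>
    if q.IsRightDivisor z then ofPath z else 0
  have φ_of : ∀ z, φ (ofPath z) = if q.IsRightDivisor z then ofPath z else 0 := fun z => by
    rw [ofPath, Module.Basis.constr_basis]
    rfl
  obtain ⟨x, hx⟩ := exists_mul_of_left_injectiveDimension_le_one I hG.1 (ofPath p)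
    φ.toAddMonoidHom (by
      intro x hx
      change φ x ∈ I
      rw [hI.mem_iff] at hx ⊢
      induction hx using Submodule.span_induction with
      | zero => rw [map_zero]; exact zero_mem _
      | add y z _ _ h1 h2 => rw [map_add]; exact add_mem h1 h2
      | smul r y _ h => rw [map_smul]; exact Submodule.smul_mem _ _ h
      | mem x hx =>
        obtain ⟨z, hz, rfl⟩ := hx
        rw [φ_of]
        split_ifs
        · exact Submodule.subset_span ⟨z, hz, rfl⟩
        · exact zero_mem _) (by
      intro r x hx
      change φ (r * x) - r * φ x ∈ I
      have hxA : x ∈ Submodule.span K (ofPath ''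
          {z : QPath V | ∀ hz : z.tgt = p.src, IsZeroPath I (z.comp p hz)}) := by
        refine basis.mem_span_image.2 fun z hz hz' => ?_
        refine hI.isZeroPath_of_coeff hx ?_
        rw [coeff_mul_ofPath_comp]
        exact Finsupp.mem_support_iff.1 hz
      clear hx
      rw [hI.mem_iff]
      induction hxA using Submodule.span_induction with
      | zero => simp
      | add y z _ _ h1 h2 =>
        have e : φ (r * (y + z)) - r * φ (y + z) =
          (φ (r * y) - r * φ y) + (φ (r * z) - r * φ z) := by
            rw [mul_add, map_add, map_add, mul_add]; abel
        rw [e]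
        exact add_mem h1 h2
      | smul k y _ h =>
        rw [mul_smul_comm, map_smul, map_smul, mul_smul_comm, ← smul_sub]
        exact Submodule.smul_mem _ _ h
      | mem x hx =>
        obtain ⟨z, hz, rfl⟩ := hx
        have hr := (basis (K := K) (V := V)).mem_span r
        induction hr using Submodule.span_induction with
        | zero => simp
        | add s t _ _ h1 h2 =>
          have e : φ ((s + t) * ofPath z) - (s + t) * φ (ofPath z) =
            (φ (s * ofPath z) - s * φ (ofPath z)) + (φ (t * ofPath z) - t * φ (ofPath z)) := by
              rw [add_mul, map_add, add_mul]; abel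
          rw [e]
          exact add_mem h1 h2
        | smul k y _ h =>
          rw [smul_mul_assoc, map_smul, smul_mul_assoc, ← smul_sub]
          exact Submodule.smul_mem _ _ h
        | mem r hr =>
          obtain ⟨r, rfl⟩ := hr
          change φ (ofPath r * ofPath z) - ofPath r * φ (ofPath z) ∈ _
          by_cases hrz : r.tgt = z.src
          · rw [φ_of z]
            by_cases hqz : q.IsRightDivisor z
            · have hq : q.IsRightDivisor (r.comp z hrz) := by
                obtain ⟨v, hv, rfl⟩ := hqz
                exact ⟨r.comp v hrz, hv, (QPath.comp_assoc _ _ _ _ _).symm⟩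
              rw [if_pos hqz, ofPath_mul_of_eq r z hrz, φ_of, if_pos hq, sub_self]
              exact zero_mem _
            · rw [if_neg hqz, mul_zero, sub_zero, ofPath_mul_of_eq r z hrz, φ_of, if_neg]
              · exact zero_mem _
              · intro hq
                have hs : q.tgt = z.tgt := by
                  obtain ⟨v, hv, e⟩ := hq
                  exact (congrArg QPath.tgt e).symm
                rcases List.suffix_or_suffix_of_suffix hq.isSuffix
                  (List.suffix_append r.arrows z.arrows) with h1 | h1
                · exact hqz (QPath.isRightDivisor_of_suffix hs h1)
                · have h2 := QPath.isRightDivisor_of_suffix hs.symm h1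
                  have h3 := hmin z h2 (hs.symm.trans h) (hz _)
                  exact hqz (h3 ▸ h2)
          · have e : ofPath r * φ (ofPath z) = 0 := by
              rw [φ_of]
              split_ifs
              · exact ofPath_mul_of_ne r z hrz
              · exact mul_zero _
            rw [e, ofPath_mul_of_ne r z hrz, map_zero, sub_zero]
            exact zero_mem _)
  refine ⟨x, ?_, fun z hz hz0 hqz => ?_⟩
  · have h1 : φ (ofPath q) - ofPath q * x ∈ I := hx (ofPath q) (by
      rw [ofPath_mul_of_eq q p h]; exact hqp)
    have hq : q.IsRightDivisor q := ⟨QPath.triv q.src, rfl, QPath.eq_of_src rfl rfl⟩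
    rwa [φ_of, if_pos hq] at h1
  · have h1 : φ (ofPath z) - ofPath z * x ∈ I := hx (ofPath z) (by
      rw [ofPath_mul_of_eq z p hz]; exact hz0)
    rw [φ_of, if_neg hqz, zero_sub] at h1
    simpa using I.neg_mem h1

end Monomial

/-! ### Perfect pairs and members of `𝔽` -/

section Monomial

open PathAlgebra

variable {K V : Type*} [Field K] [Quiver V] [Fintype V] {I : TwoSidedIdeal (PathAlgebra K V)}

theorem IsMonomial.two_le_length (hI : IsMonomial I) {p : QPath V} (hp : IsZeroPath I p) :
    2 ≤ p.length :=
  hI.1.2 _ hp p (by rw [coeff_ofPath_self]; exact one_ne_zero)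

theorem exists_minimalZeroPath_isSubpath {p : QPath V} (hp : IsZeroPath I p) :
    ∃ f ∈ minimalZeroPaths I, f.IsSubpath p := by
  obtain ⟨f, ⟨h1, h2⟩, h3⟩ := WellFounded.has_min (measure (QPath.length (V := V))).wf
    {f : QPath V | IsZeroPath I f ∧ f.IsSubpath p} ⟨p, hp, p.isSubpath_refl⟩
  refine ⟨f, ⟨h1, fun q hq hq0 => hq.eq_of_length ?_⟩, h2⟩
  exact not_lt.1 (h3 q ⟨hq0, QPath.isSubpath_trans hq h2⟩)

theorem not_isZeroPath_of_isSubpath {f p : QPath V} (hf : f ∈ minimalZeroPaths I)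
    (hp : p.IsSubpath f) (hl : p.length < f.length) : ¬ IsZeroPath I p := fun h => by
  rw [hf.2 p hp h] at hl
  exact lt_irrefl _ hl

/-- As neither factor is zero, a zero subpath of the product must straddle the junction. -/
theorem exists_split_of_isSubpath (hI : IsMonomial I) {p q f : QPath V} (h : p.tgt = q.src)
    (hp : ¬ IsZeroPath I p) (hq : ¬ IsZeroPath I q) (hf : IsZeroPath I f)
    (hs : f.IsSubpath (p.comp q h)) :
    ∃ (p₁ p₂ q₁ q₂ : QPath V) (h₁ : p₁.tgt = p₂.src) (h₂ : q₁.tgt = q₂.src) (h₃ : p₂.tgt = q₁.src),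
      p = p₁.comp p₂ h₁ ∧ q = q₁.comp q₂ h₂ ∧ f = p₂.comp q₁ h₃ ∧ 0 < p₂.length ∧ 0 < q₁.length := by
  have hfl : 0 < f.length := lt_of_lt_of_le two_pos (hI.two_le_length hf)
  have hfp : ¬ f.arrows <:+: p.arrows := fun e =>
    hp (hf.of_isSubpath (QPath.isSubpath_of_infix hfl e))
  have hfq : ¬ f.arrows <:+: q.arrows := fun e =>
    hq (hf.of_isSubpath (QPath.isSubpath_of_infix hfl e))
  obtain ⟨s, t, hst⟩ := hs.isInfix
  change s ++ f.arrows ++ t = p.arrows ++ q.arrows at hst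
  rw [List.append_assoc, List.append_eq_append_iff] at hst
  rcases hst with ⟨a, h1, h2⟩ | ⟨c, h1, h2⟩
  · rw [List.append_eq_append_iff] at h2
    rcases h2 with ⟨b, h3, h4⟩ | ⟨b, h3, h4⟩
    · exact absurd ⟨s, b, by rw [h1, h3, List.append_assoc]⟩ hfp
    · have ha : a ≠ [] := by
        rintro rfl
        exact hfq ⟨[], t, by rw [h3, h4]; rfl⟩
      have hb : b ≠ [] := by
        rintro rfl
        exact hfp ⟨s, [], by rw [h1, h3]; simp⟩
      obtain ⟨p₁, p₂, h₁, rfl, -, hp₂⟩ := QPath.exists_comp h1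
      obtain ⟨q₁, q₂, h₂, rfl, hq₁, -⟩ := QPath.exists_comp h4
      refine ⟨p₁, p₂, q₁, q₂, h₁, h₂, h, rfl, rfl, ?_, ?_, ?_⟩
      · refine QPath.eq_of_arrows hfl ?_
        rw [h3, ← hp₂, ← hq₁]
        rfl
      · rw [← hp₂] at ha
        exact List.length_pos_iff.2 ha
      · rw [← hq₁] at hb
        exact List.length_pos_iff.2 hb
  · exact absurd ⟨c, t, by rw [h2, List.append_assoc]⟩ hfq

theorem IsMonomial.coeff_eq_zero (hI : IsMonomial I) {x : PathAlgebra K V} (hx : x ∈ I)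
    {p : QPath V} (hp : ¬ IsZeroPath I p) : x.coeff p = 0 :=
  by_contra fun h => hp (hI.isZeroPath_of_coeff hx h)

/-- Otherwise the multiplier fixing `q` and killing `q'` modulo `I` would have both coefficient 1
and coefficient 0 at the trivial path at `t(p)`, the common source of `q` and `q'`. -/
theorem isLeftDivisor_of_minimal (hI : IsMonomial I)
    (hG : IsIwanagaGorenstein 1 (BoundQuiverAlgebra I)) {p q : QPath V} (h : p.tgt = q.src)
    (hq : ¬ IsZeroPath I q) (hpq : IsZeroPath I (p.comp q h))
    (hmin : ∀ u : QPath V, u.IsLeftDivisor q → ∀ hu : p.tgt = u.src,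
      IsZeroPath I (p.comp u hu) → u = q)
    {q' : QPath V} (h' : p.tgt = q'.src) (hq' : ¬ IsZeroPath I q')
    (hpq' : IsZeroPath I (p.comp q' h')) : q.IsLeftDivisor q' := by
  by_contra hd
  obtain ⟨x, hx, hx'⟩ := exists_left_multiplier hI hG h hpq hmin (fun z hz hz0 _ => hz0) rfl
  have h1 := hI.coeff_eq_zero hx hq
  have h2 := hI.coeff_eq_zero (hx' q' h' hpq' hd) hq'
  rw [coeff_sub, coeff_ofPath_self, coeff_mul_ofPath_self] at h1
  rw [coeff_mul_ofPath_self, ← h', h] at h2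
  rw [h2, sub_zero] at h1
  exact one_ne_zero h1

theorem isRightDivisor_of_minimal (hI : IsMonomial I)
    (hG : IsIwanagaGorenstein 1 (BoundQuiverAlgebra I)) {p q : QPath V} (h : q.tgt = p.src)
    (hq : ¬ IsZeroPath I q) (hqp : IsZeroPath I (q.comp p h))
    (hmin : ∀ u : QPath V, u.IsRightDivisor q → ∀ hu : u.tgt = p.src,
      IsZeroPath I (u.comp p hu) → u = q)
    {q' : QPath V} (h' : q'.tgt = p.src) (hq' : ¬ IsZeroPath I q')
    (hqp' : IsZeroPath I (q'.comp p h')) : q.IsRightDivisor q' := by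
  by_contra hd
  obtain ⟨x, hx, hx'⟩ := exists_right_multiplier hI hG h hqp hmin
  have h1 := hI.coeff_eq_zero hx hq
  have h2 := hI.coeff_eq_zero (hx' q' h' hqp' hd) hq'
  rw [coeff_sub, coeff_ofPath_self, coeff_ofPath_mul_self] at h1
  rw [coeff_ofPath_mul_self, h', ← h] at h2
  rw [h2, sub_zero] at h1
  exact one_ne_zero h1

theorem eq_of_isLeftDivisor_of_comp_mem {p q : QPath V} (h : p.tgt = q.src)
    (hf : p.comp q h ∈ minimalZeroPaths I) (u : QPath V) (hu : u.IsLeftDivisor q)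
    (hu' : p.tgt = u.src) (h0 : IsZeroPath I (p.comp u hu')) : u = q := by
  obtain ⟨v, hv, rfl⟩ := hu
  have hs : (p.comp u hu').IsSubpath (p.comp (u.comp v hv) h) := by
    rw [← QPath.comp_assoc p u v hu' hv]
    exact (QPath.isLeftDivisor_comp _ _ _).isSubpath
  exact QPath.comp_left_cancel (hf.2 _ hs h0)

theorem eq_of_isRightDivisor_of_comp_mem {p q : QPath V} (h : p.tgt = q.src)
    (hf : p.comp q h ∈ minimalZeroPaths I) (u : QPath V) (hu : u.IsRightDivisor p)
    (hu' : u.tgt = q.src) (h0 : IsZeroPath I (u.comp q hu')) : u = p := by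
  obtain ⟨v, hv, rfl⟩ := hu
  have hs : (u.comp q hu').IsSubpath ((v.comp u hv).comp q h) := by
    rw [QPath.comp_assoc v u q hv hu']
    exact (QPath.isRightDivisor_comp v (u.comp q hu') hv).isSubpath
  exact QPath.comp_right_cancel (hf.2 _ hs h0)

theorem isPerfectPair_of_comp_mem (hI : IsMonomial I)
    (hG : IsIwanagaGorenstein 1 (BoundQuiverAlgebra I)) {p q : QPath V} (h : p.tgt = q.src)
    (hp : 0 < p.length) (hq : 0 < q.length) (hf : p.comp q h ∈ minimalZeroPaths I) :
    IsPerfectPair I p q := by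
  have hl := QPath.length_comp p q h
  have hp0 : ¬ IsZeroPath I p :=
    not_isZeroPath_of_isSubpath hf (QPath.isLeftDivisor_comp _ _ _).isSubpath (by omega)
  have hq0 : ¬ IsZeroPath I q :=
    not_isZeroPath_of_isSubpath hf (QPath.isRightDivisor_comp _ _ _).isSubpath (by omega)
  exact
    { left_nonzero := hp0
      right_nonzero := hq0
      left_nontrivial := hp
      right_nontrivial := hq
      comp_zero := ⟨h, hf.1⟩
      left_divisor := fun _ h' hq' hpq' => isLeftDivisor_of_minimal hI hG h hq0 hf.1
        (eq_of_isLeftDivisor_of_comp_mem h hf) h' hq' hpq'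
      right_divisor := fun _ h' hp' hpq' => isRightDivisor_of_minimal hI hG h hp0 hf.1
        (eq_of_isRightDivisor_of_comp_mem h hf) h' hp' hpq' }

/-- A zero subpath straddles the junction as `p₂q₁`. Since `p₂q = 0`, perfectness gives `p₂ = p`;
then `pq₁ = 0` gives `q₁ = q`. -/
theorem IsPerfectPair.comp_mem (hI : IsMonomial I) {p q : QPath V} (hpq : IsPerfectPair I p q) :
    ∃ h : p.tgt = q.src, p.comp q h ∈ minimalZeroPaths I := by
  obtain ⟨h, h0⟩ := hpq.comp_zero
  refine ⟨h, h0, fun f hf hf0 => ?_⟩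
  obtain ⟨p₁, p₂, q₁, q₂, h₁, h₂, h₃, hp, hq, rfl, -, -⟩ :=
    exists_split_of_isSubpath hI h hpq.left_nonzero hpq.right_nonzero hf0 hf
  have hp₂ : p₂.IsRightDivisor p := hp ▸ QPath.isRightDivisor_comp _ _ _
  have hq₁ : q₁.IsLeftDivisor q := hq ▸ QPath.isLeftDivisor_comp _ _ _
  have hp₂' : p₂.tgt = p.tgt := by rw [hp]; rfl
  have hq₁' : q₁.src = q.src := by rw [hq]; rfl
  have e1 : p₂ = p := hp₂.antisymm (hpq.right_divisor p₂ (h₃.trans hq₁')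
    (fun e => hpq.left_nonzero (e.of_isSubpath hp₂.isSubpath)) (by
      refine hf0.of_isSubpath ?_
      have e : p₂.comp q (h₃.trans hq₁') = (p₂.comp q₁ h₃).comp q₂ h₂ :=
        QPath.eq_of_src rfl (by simp [hq, QPath.comp])
      rw [e]
      exact (QPath.isLeftDivisor_comp _ _ _).isSubpath))
  have e2 : q₁ = q := hq₁.antisymm (hpq.left_divisor q₁ (hp₂'.symm.trans h₃)
    (fun e => hpq.right_nonzero (e.of_isSubpath hq₁.isSubpath)) (by
      subst e1
      exact hf0))
  subst e1 e2
  rfl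

/-- The assignment `qv ↦ yv` is well defined by the annihilator condition, so `y` is a left multiple
of `q` modulo `I`; being non-zero, it must occur in that multiple. -/
theorem isRightDivisor_of_annihilator (hI : IsMonomial I)
    (hG : IsIwanagaGorenstein 1 (BoundQuiverAlgebra I)) {p q y : QPath V} (h : p.tgt = q.src)
    (hf : p.comp q h ∈ minimalZeroPaths I) (hy : ¬ IsZeroPath I y) (hyq : y.tgt = q.tgt)
    (hann : ∀ (z : QPath V) (hz : q.tgt = z.src), IsZeroPath I (q.comp z hz) →
      ∀ hz' : y.tgt = z.src, IsZeroPath I (y.comp z hz')) : q.IsRightDivisor y := by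
  obtain ⟨x, hx, -⟩ := exists_left_multiplier hI hG h hf.1
    (eq_of_isLeftDivisor_of_comp_mem h hf) hann hyq
  have h1 := hI.coeff_eq_zero hx hy
  rw [coeff_sub, coeff_ofPath_self, sub_eq_zero] at h1
  exact isRightDivisor_of_coeff_mul_ne_zero (h1 ▸ one_ne_zero)

/-- The continuation `r` is a shortest non-zero path killed by `q`; it makes `qr` minimal because a
shorter right factor of `q` with the same annihilator would have to be divisible by `q`. -/
theorem exists_comp_mem_of_comp_mem (hI : IsMonomial I)
    (hG : IsIwanagaGorenstein 1 (BoundQuiverAlgebra I)) {p q : QPath V} (h : p.tgt = q.src)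
    (hp : 0 < p.length) (hq : 0 < q.length) (hf : p.comp q h ∈ minimalZeroPaths I) :
    ∃ (r : QPath V) (h' : q.tgt = r.src), q.comp r h' ∈ minimalZeroPaths I := by
  have hpq := isPerfectPair_of_comp_mem hI hG h hp hq hf
  have hex : ∃ z : QPath V, ¬ IsZeroPath I z ∧ ∃ hz : q.tgt = z.src, IsZeroPath I (q.comp z hz) := by
    by_contra! hno
    -- If `q` killed no non-zero path, it would be a right divisor of the trivial path at its
    -- target.
    have hd := isRightDivisor_of_annihilator hI hG h hf (y := QPath.triv q.tgt)
      (fun e => absurd (hI.two_le_length e) (by simp [QPath.length, QPath.triv])) rfl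
      (fun z hz hz0 hz' => by
        have e : (QPath.triv q.tgt).comp z hz' = z := QPath.eq_of_src hz rfl
        rw [e]
        by_contra hz1
        exact hno z hz1 hz hz0)
    have hl := hd.isSuffix.length_le
    simp only [QPath.triv, List.length_nil] at hl
    exact absurd hq (not_lt.2 hl)
  obtain ⟨z, ⟨hz0, hz, hqz⟩, hzmin⟩ := WellFounded.has_min (measure (QPath.length (V := V))).wf
    {z : QPath V | ¬ IsZeroPath I z ∧ ∃ hz : q.tgt = z.src, IsZeroPath I (q.comp z hz)} hex
  have hmin : ∀ u : QPath V, u.IsLeftDivisor z → ∀ hu : q.tgt = u.src,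
      IsZeroPath I (q.comp u hu) → u = z := fun u hu hu' hqu =>
    hu.isSubpath.eq_of_length (not_lt.1 (hzmin u
      ⟨fun e => hz0 (e.of_isSubpath hu.isSubpath), hu', hqu⟩))
  obtain ⟨f, hfF, hfs⟩ := exists_minimalZeroPath_isSubpath hqz
  obtain ⟨q₁, q₂, z₁, z₂, h₁, h₂, h₃, hq', hz', rfl, hq₂, hz₁⟩ :=
    exists_split_of_isSubpath hI hz hpq.right_nonzero hz0 hfF.1 hfs
  have hq₂q : q₂.IsRightDivisor q := hq' ▸ QPath.isRightDivisor_comp _ _ _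
  have hq₂t : q.tgt = q₂.tgt := by rw [hq']; rfl
  have hz₁z : z₁ = z := by
    refine hmin z₁ (hz' ▸ QPath.isLeftDivisor_comp _ _ _) (hq₂t.trans h₃) ?_
    refine hfF.1.of_isSubpath (QPath.IsRightDivisor.isSubpath ⟨q₁, h₁, ?_⟩)
    exact QPath.eq_of_tgt rfl (by simp [hq', QPath.comp])
  subst hz₁z
  -- Every non-zero path killed by `q` begins with `z₁`, and `q₂z₁ = 0`; so `q₂` kills whatever `q`
  -- kills.
  have hd : q.IsRightDivisor q₂ := by
    refine isRightDivisor_of_annihilator hI hG h hf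
      (fun e => hpq.right_nonzero (e.of_isSubpath hq₂q.isSubpath)) hq₂t.symm fun w hw hqw hw' => ?_
    by_cases hw0 : IsZeroPath I w
    · exact hw0.of_isSubpath (QPath.isRightDivisor_comp _ _ _).isSubpath
    · obtain ⟨v, hv, rfl⟩ := isLeftDivisor_of_minimal hI hG hz hz0 hqz hmin hw hw0 hqw
      refine hfF.1.of_isSubpath (QPath.IsLeftDivisor.isSubpath ⟨v, hv, ?_⟩)
      exact (QPath.comp_assoc _ _ _ _ _).symm
  obtain rfl := hd.antisymm hq₂q
  exact ⟨z₁, hz, hfF⟩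

theorem length_pos_of_comp_mem {p q : QPath V} (h : p.tgt = q.src)
    (hf : p.comp q h ∈ minimalZeroPaths I) (hp : ¬ IsZeroPath I p) : 0 < q.length := by
  rw [Nat.pos_iff_ne_zero]
  intro h0
  refine hp ?_
  have e : p.comp q h = p := QPath.eq_of_src rfl (by
    change p.arrows ++ q.arrows = p.arrows
    rw [List.length_eq_zero_iff.1 h0, List.append_nil])
  exact e ▸ hf.1

/-- Admissibility bounds the length of non-zero paths, and there are finitely many vertices and
arrows. -/
theorem IsMonomial.finite_nonzero [Finite (Quiver.Total V)] (hI : IsMonomial I) :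
    {p : QPath V | ¬ IsZeroPath I p}.Finite := by
  obtain ⟨N, -, hN⟩ := hI.1.1
  refine Set.Finite.of_finite_image (f := fun p : QPath V => (p.src, p.arrows))
    ((Set.finite_univ.prod (List.finite_length_lt (Quiver.Total V) N)).subset ?_) ?_
  · rintro _ ⟨p, hp, rfl⟩
    exact ⟨trivial, not_le.1 fun h => hp (hN p h)⟩
  · intro p _ q _ e
    exact QPath.eq_of_src (congrArg Prod.fst e) (congrArg Prod.snd e)

/-- Passing to the second member of a perfect pair is an injective self-map of the finite set on the
right-hand side; each of its orbits is therefore periodic and forms a perfect path sequence. -/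
theorem isPerfect_iff [Finite (Quiver.Total V)] (hI : IsMonomial I)
    (hG : IsIwanagaGorenstein 1 (BoundQuiverAlgebra I)) {p : QPath V} :
    IsPerfect I p ↔ ¬ IsZeroPath I p ∧ 0 < p.length ∧
      ∃ (q : QPath V) (h : p.tgt = q.src), p.comp q h ∈ minimalZeroPaths I := by
  constructor
  · rintro ⟨n, _, s, hs, i, rfl⟩
    exact ⟨(hs i).left_nonzero, (hs i).left_nontrivial, _, (hs i).comp_mem hI⟩
  · intro hp
    let X := {p : QPath V // ¬ IsZeroPath I p ∧ 0 < p.length ∧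
      ∃ (q : QPath V) (h : p.tgt = q.src), p.comp q h ∈ minimalZeroPaths I}
    have hX : Finite X := (hI.finite_nonzero.subset fun p hp => hp.1 :
      {p : QPath V | ¬ IsZeroPath I p ∧ 0 < p.length ∧
        ∃ (q : QPath V) (h : p.tgt = q.src), p.comp q h ∈ minimalZeroPaths I}.Finite)
    have hsucc : ∀ x : X, ∃ y : X, IsPerfectPair I x.1 y.1 := by
      rintro ⟨p, h0, hl, q, h, hf⟩
      have hq := length_pos_of_comp_mem h hf h0
      have hpq := isPerfectPair_of_comp_mem hI hG h hl hq hf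
      exact ⟨⟨q, hpq.right_nonzero, hq, exists_comp_mem_of_comp_mem hI hG h hl hq hf⟩, hpq⟩
    choose σ hσ using hsucc
    have hinj : Function.Injective σ := fun x y hxy => by
      have hx := hσ x
      have hy := hσ y
      rw [hxy] at hx
      obtain ⟨h1, h1'⟩ := hx.comp_zero
      obtain ⟨h2, h2'⟩ := hy.comp_zero
      exact Subtype.ext ((hx.right_divisor _ h2 hy.left_nonzero h2').antisymm
        (hy.right_divisor _ h1 hx.left_nonzero h1'))
    obtain ⟨n, hn, hper⟩ := hinj.mem_periodicPts (⟨p, hp⟩ : X)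
    have hn' : NeZero n := ⟨hn.ne'⟩
    refine ⟨n, hn', fun i => (σ^[(i : ℕ)] ⟨p, hp⟩).1, fun i => ?_, 0, by simp⟩
    -- Addition in `Fin n` wraps around; the period `n` of the orbit absorbs this.
    have e : σ^[((i + 1 : Fin n) : ℕ)] (⟨p, hp⟩ : X) = σ (σ^[(i : ℕ)] ⟨p, hp⟩) := by
      rw [← Function.iterate_succ_apply' σ, Nat.succ_eq_add_one, Fin.val_add,
        ← hper.iterate_mod_apply (i + 1)]
      simp
    have h := hσ (σ^[(i : ℕ)] ⟨p, hp⟩)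
    rwa [← e] at h

/-- Write `f = upv`. If `u` is trivial, then `pv ∈ 𝔽`; otherwise `pv` continues to some `pvr ∈ 𝔽`.
Either way `p` is a left factor of a member of `𝔽`. -/
theorem isPerfect_of_isSubpath [Finite (Quiver.Total V)] (hI : IsMonomial I)
    (hG : IsIwanagaGorenstein 1 (BoundQuiverAlgebra I)) {f p : QPath V}
    (hf : f ∈ minimalZeroPaths I) (hp : p.IsSubpath f) (hl : 0 < p.length)
    (hlt : p.length < f.length) : IsPerfect I p := by
  have hp0 := not_isZeroPath_of_isSubpath hf hp hlt
  obtain ⟨u, v, h₁, h₂, rfl⟩ := hp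
  rw [isPerfect_iff hI hG]
  refine ⟨hp0, hl, ?_⟩
  rcases Nat.eq_zero_or_pos u.length with hu | hu
  · have e : (u.comp p h₁).comp v h₂ = p.comp v h₂ := by
      refine QPath.eq_of_tgt rfl ?_
      change u.arrows ++ p.arrows ++ v.arrows = p.arrows ++ v.arrows
      rw [List.length_eq_zero_iff.1 hu, List.nil_append]
    exact ⟨v, h₂, e ▸ hf⟩
  · have e : (u.comp p h₁).comp v h₂ = u.comp (p.comp v h₂) h₁ := QPath.comp_assoc _ _ _ _ _
    rw [e] at hf
    obtain ⟨r, h, hr⟩ := exists_comp_mem_of_comp_mem hI hG (q := p.comp v h₂) h₁ hu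
      (by rw [QPath.length_comp]; omega) hf
    exact ⟨v.comp r h, h₂, QPath.comp_assoc p v r h₂ h ▸ hr⟩

end Monomial

/-! ### Concatenations as lists of arrows -/

namespace QPath

variable {V : Type*} [Quiver V]

theorem IsConcat.arrows_eq {L : List (QPath V)} {w : QPath V} (h : IsConcat L w) :
    w.arrows = (L.map QPath.arrows).flatten := by
  induction h with
  | single p => simp
  | cons p L q h _ ih => simp [comp, ih]

theorem isConcat_map_ofArrow (u v : V) (l : List (Quiver.Total V)) (h : IsWalk u l v)
    (hl : l ≠ []) : IsConcat (l.map ofArrow) ⟨u, l, v, h⟩ := by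
  induction l generalizing u with
  | nil => exact absurd rfl hl
  | cons a l ih =>
    obtain ⟨rfl, h2⟩ := h
    cases l with
    | nil =>
      obtain rfl : a.right = v := h2
      exact .single _
    | cons b l => exact .cons (ofArrow a) _ _ rfl (ih _ h2 (by simp))

theorem eq_ofArrow {p : QPath V} {a : Quiver.Total V} (h : p.arrows = [a]) : p = ofArrow a :=
  eq_of_arrows (by simp [length, h]) h

theorem eq_map_ofArrow_flatten (L : List (QPath V)) (h : ∀ p ∈ L, p.length = 1) :
    L = ((L.map QPath.arrows).flatten).map ofArrow := by
  induction L with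
  | nil => rfl
  | cons p L ih =>
    obtain ⟨a, ha⟩ := List.length_eq_one_iff.1 (h p List.mem_cons_self)
    rw [List.map_cons, List.flatten_cons, List.map_append,
      ← ih fun q hq => h q (List.mem_cons_of_mem _ hq), ha]
    rw [eq_ofArrow ha]
    rfl

end QPath

theorem List.getElem?_flatten_replicate {α : Type*} (u : List α) (m j : ℕ) (hj : j < m * u.length) :
    (List.replicate m u).flatten[j]? = u[j % u.length]? := by
  induction m generalizing j with
  | zero => omega
  | succ m ih =>
    rw [List.replicate_succ, List.flatten_cons]
    rcases lt_or_ge j u.length with h | h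
    · rw [List.getElem?_append_left h, Nat.mod_eq_of_lt h]
    · rw [List.getElem?_append_right h, ih _ (by rw [Nat.succ_mul] at hj; omega),
        Nat.mod_eq_sub_mod h]

/-! ### Co-elementary paths, counting, and consecutive perfect paths -/

section Monomial

variable {K V : Type*} [Field K] [Quiver V] [Fintype V] {I : TwoSidedIdeal (PathAlgebra K V)}

theorem isPerfect_ofArrow_of_mem [Finite (Quiver.Total V)] (hI : IsMonomial I)
    (hG : IsIwanagaGorenstein 1 (BoundQuiverAlgebra I)) {f : QPath V}
    (hf : f ∈ minimalZeroPaths I) {a : Quiver.Total V} (ha : a ∈ f.arrows) :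
    IsPerfect I (QPath.ofArrow a) := by
  obtain ⟨s, t, hst⟩ := List.append_of_mem ha
  refine isPerfect_of_isSubpath hI hG hf (QPath.isSubpath_of_infix Nat.one_pos
    ⟨s, t, ?_⟩) Nat.one_pos (hI.two_le_length hf.1)
  rw [hst]
  simp [QPath.ofArrow]

/-- The first arrow of a perfect path is itself perfect, so a perfect path of length greater than
one has a proper perfect left divisor and is not a sink. -/
theorem isCoelementary_iff [Finite (Quiver.Total V)] (hI : IsMonomial I)
    (hG : IsIwanagaGorenstein 1 (BoundQuiverAlgebra I)) {p : QPath V} :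
    IsCoelementary I p ↔ IsPerfect I p ∧ p.length = 1 := by
  constructor
  · rintro ⟨hp, hsink⟩
    refine ⟨hp, ?_⟩
    obtain ⟨-, hl, q, h, hf⟩ := (isPerfect_iff hI hG).1 hp
    obtain ⟨a, l, hal⟩ := List.exists_cons_of_length_pos hl
    by_contra hne
    have ha : IsPerfect I (QPath.ofArrow a) := isPerfect_ofArrow_of_mem hI hG hf (by
      change a ∈ p.arrows ++ q.arrows
      simp [hal])
    have had : (QPath.ofArrow a).IsProperLeftDivisor p := by
      have hpre : (QPath.ofArrow a).arrows <+: p.arrows := ⟨l, hal.symm⟩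
      refine ⟨QPath.isLeftDivisor_of_prefix (QPath.src_eq_of_prefix Nat.one_pos hpre) hpre, ?_⟩
      rintro rfl
      exact hne rfl
    -- A longest proper perfect left divisor leaves nothing in between, and so is the end of a Hasse
    -- arrow.
    obtain ⟨r, ⟨hr, hrp⟩, hmax⟩ := WellFounded.has_min
      (measure (fun r : QPath V => p.length - r.length)).wf
      {r : QPath V | IsPerfect I r ∧ r.IsProperLeftDivisor p} ⟨_, ha, had⟩
    refine hsink r ⟨hp, hr, hrp, ?_⟩
    rintro ⟨t, ht, hrt, htp⟩
    have h1 := hmax t ⟨ht, htp⟩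
    have h2 := htp.1.isPrefix.length_le
    have h3 := hrt.1.isPrefix.length_le
    refine hrt.2 (hrt.1.isSubpath.eq_of_length ?_)
    change ¬ (p.length - t.length < p.length - r.length) at h1
    change t.length ≤ p.length at h2
    change r.length ≤ t.length at h3
    omega
  · rintro ⟨hp, hl⟩
    refine ⟨hp, fun q hq => hq.2.2.1.2 (hq.2.2.1.1.isSubpath.eq_of_length ?_)⟩
    rw [hl]
    exact ((isPerfect_iff hI hG).1 hq.2.1).2.1

/-- Only one member of `𝔽` begins with `a`, so the perfect paths beginning with `a` are the proper
non-trivial left divisors of `f`, one for each length from 1 to `l(f) - 1`. -/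
theorem ncard_perfect_of_mem [Finite (Quiver.Total V)] (hI : IsMonomial I)
    (hG : IsIwanagaGorenstein 1 (BoundQuiverAlgebra I)) {f : QPath V}
    (hf : f ∈ minimalZeroPaths I) {a : Quiver.Total V} {l : List (Quiver.Total V)}
    (hal : f.arrows = a :: l) :
    {p : QPath V | IsPerfect I p ∧ (QPath.ofArrow a).IsLeftDivisor p}.ncard = f.length - 1 := by
  have hf2 := hI.two_le_length hf.1
  have hdec : ∀ g : QPath V, g ∈ minimalZeroPaths I → (QPath.ofArrow a).IsLeftDivisor g →
      ∃ (v : QPath V) (h : (QPath.ofArrow a).tgt = v.src), g = (QPath.ofArrow a).comp v h ∧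
        IsPerfectPair I (QPath.ofArrow a) v := by
    rintro _ hg ⟨v, h, rfl⟩
    refine ⟨v, h, rfl, isPerfectPair_of_comp_mem hI hG h Nat.one_pos ?_ hg⟩
    have h2 := hI.two_le_length hg.1
    rw [QPath.length_comp] at h2
    have h1 : (QPath.ofArrow a).length = 1 := rfl
    omega
  have haf : (QPath.ofArrow a).IsLeftDivisor f := by
    have hpre : (QPath.ofArrow a).arrows <+: f.arrows := ⟨l, hal.symm⟩
    exact QPath.isLeftDivisor_of_prefix (QPath.src_eq_of_prefix Nat.one_pos hpre) hpre
  have hsub : ∀ p : QPath V, IsPerfect I p → (QPath.ofArrow a).IsLeftDivisor p →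
      p.IsLeftDivisor f ∧ 0 < p.length ∧ p.length < f.length := by
    intro p hp hap
    obtain ⟨hp0, hpl, q, h, hg⟩ := (isPerfect_iff hI hG).1 hp
    have hq := length_pos_of_comp_mem h hg hp0
    have hag : (QPath.ofArrow a).IsLeftDivisor (p.comp q h) := by
      obtain ⟨v, hv, rfl⟩ := hap
      exact ⟨v.comp q h, hv, QPath.comp_assoc (QPath.ofArrow a) v q hv h⟩
    obtain ⟨v, hv, e, hv'⟩ := hdec _ hg hag
    obtain ⟨u, hu, e', hu'⟩ := hdec _ hf haf
    obtain ⟨h1, h1'⟩ := hv'.comp_zero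
    obtain ⟨h2, h2'⟩ := hu'.comp_zero
    -- The second member of a perfect pair is determined by the first.
    obtain rfl : u = v := (hu'.left_divisor _ h1 hv'.right_nonzero h1').antisymm
      (hv'.left_divisor _ h2 hu'.right_nonzero h2')
    have hfe : f = p.comp q h := e'.trans e.symm
    rw [hfe, QPath.length_comp]
    exact ⟨QPath.isLeftDivisor_comp _ _ _, hpl, by omega⟩
  have himg : QPath.length '' {p : QPath V | IsPerfect I p ∧ (QPath.ofArrow a).IsLeftDivisor p} =
      (Finset.Icc 1 (f.length - 1) : Set ℕ) := by
    ext k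
    simp only [Set.mem_image, Set.mem_ofPred_eq, Finset.coe_Icc, Set.mem_Icc]
    constructor
    · rintro ⟨p, ⟨hp, hap⟩, rfl⟩
      obtain ⟨-, h1, h2⟩ := hsub p hp hap
      omega
    · rintro ⟨hk1, hk2⟩
      obtain ⟨p, q, h, hfe, hp, -⟩ := QPath.exists_comp (List.take_append_drop k f.arrows).symm
      have hpk : p.length = k := by
        rw [QPath.length, hp, List.length_take]
        change min k f.length = k
        omega
      have hpf : p.IsLeftDivisor f := ⟨q, h, hfe⟩
      refine ⟨p, ⟨isPerfect_of_isSubpath hI hG hf hpf.isSubpath (by omega) (by omega), ?_⟩, hpk⟩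
      have hpre : (QPath.ofArrow a).arrows <+: p.arrows := by
        rw [hp, hal]
        obtain ⟨k, rfl⟩ : ∃ k', k = k' + 1 := ⟨k - 1, by omega⟩
        exact ⟨l.take k, rfl⟩
      exact QPath.isLeftDivisor_of_prefix (QPath.src_eq_of_prefix Nat.one_pos hpre) hpre
  have hinj : Set.InjOn QPath.length
      {p : QPath V | IsPerfect I p ∧ (QPath.ofArrow a).IsLeftDivisor p} := by
    rintro p ⟨hp, hap⟩ q ⟨hq, haq⟩ hpq
    obtain ⟨v, hv, e⟩ := (hsub p hp hap).1
    obtain ⟨v', hv', e'⟩ := (hsub q hq haq).1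
    have e'' : p.comp v hv = q.comp v' hv' := e.symm.trans e'
    have hs : (p.comp v hv).src = (q.comp v' hv').src := congrArg QPath.src e''
    exact QPath.eq_of_src hs
      (List.append_inj (congrArg QPath.arrows e'') hpq).1
  rw [← hinj.ncard_image, himg, Set.ncard_coe_finset, Nat.card_Icc]
  omega

/-- Starting in the middle of `p`, one still meets a member of `𝔽` before the end of `r`. For `p =
uv` with `u` non-trivial, `vq` continues to some `vqz ∈ 𝔽`; since `vqr = 0`, the path `z` is a left
divisor of `r`. -/
theorem exists_minimalZeroPath_of_consecutive (hI : IsMonomial I)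
    (hG : IsIwanagaGorenstein 1 (BoundQuiverAlgebra I)) {p q r : QPath V}
    (hpq : IsPerfectPair I p q) (hqr : IsPerfectPair I q r) {u v : List (Quiver.Total V)}
    (huv : p.arrows = u ++ v) (hv : v ≠ []) :
    ∃ f ∈ minimalZeroPaths I, ∃ t, v ++ (q.arrows ++ r.arrows) = f.arrows ++ t := by
  obtain ⟨h, hf⟩ := hpq.comp_mem hI
  obtain ⟨p₁, p₂, h', rfl, rfl, rfl⟩ := QPath.exists_comp huv
  rcases Nat.eq_zero_or_pos p₁.length with hl | hl
  · refine ⟨_, hf, r.arrows, ?_⟩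
    change _ = p₁.arrows ++ p₂.arrows ++ q.arrows ++ r.arrows
    rw [List.length_eq_zero_iff.1 hl]
    simp
  · have hf' : p₁.comp (p₂.comp q h) h' ∈ minimalZeroPaths I := QPath.comp_assoc p₁ p₂ q h' h ▸ hf
    have hpos : 0 < (p₂.comp q h).length :=
      lt_of_lt_of_eq (Nat.add_pos_left (List.length_pos_iff.2 hv) _)
        (QPath.length_comp p₂ q h).symm
    have hpair := isPerfectPair_of_comp_mem hI hG (q := p₂.comp q h) h' hl hpos hf'
    obtain ⟨z, hz, hzf⟩ := exists_comp_mem_of_comp_mem hI hG (q := p₂.comp q h) h' hl hpos hf'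
    have hzpair := isPerfectPair_of_comp_mem hI hG hz hpos
      (length_pos_of_comp_mem hz hzf hpair.right_nonzero) hzf
    obtain ⟨h₁, h₁'⟩ := hqr.comp_zero
    obtain ⟨t, ht, hrt⟩ := hzpair.left_divisor r h₁ hqr.right_nonzero (by
      refine h₁'.of_isSubpath (QPath.IsRightDivisor.isSubpath ⟨p₂, h, ?_⟩)
      exact QPath.comp_assoc p₂ q r h h₁)
    refine ⟨_, hzf, t.arrows, ?_⟩
    rw [hrt]
    simp [QPath.comp]

end Monomial

/-! ### Underlying cycles -/

section Monomial

variable {K V : Type*} [Field K] [Quiver V] [Fintype V] {I : TwoSidedIdeal (PathAlgebra K V)}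

theorem IsPerfectSequence.pair_ofNat {n : ℕ} [NeZero n] {s : Fin n → QPath V}
    (hs : IsPerfectSequence I s) (k : ℕ) :
    IsPerfectPair I (s (Fin.ofNat n k)) (s (Fin.ofNat n (k + 1))) := by
  have e : Fin.ofNat n (k + 1) = Fin.ofNat n k + 1 := by
    ext
    simp [Fin.val_add, Nat.add_mod]
  rw [e]
  exact hs _

theorem flatten_range_mul {α : Type*} {n : ℕ} [NeZero n] (g : Fin n → List α) (k : ℕ) :
    ((List.range (n * k)).map fun j => g (Fin.ofNat n j)).flatten =
      (List.replicate k (List.ofFn g).flatten).flatten := by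
  induction k with
  | zero => simp
  | succ k ih =>
    have e : (List.range n).map ((fun j => g (Fin.ofNat n j)) ∘ fun x => n * k + x) =
        List.ofFn g := by
      refine List.ext_getElem (by simp) fun i h1 h2 => ?_
      simp only [List.length_ofFn] at h2
      simp only [List.getElem_map, List.getElem_range, List.getElem_ofFn, Function.comp_apply]
      congr 1
      ext
      simp [Nat.mod_eq_of_lt h2]
    rw [Nat.mul_succ, List.range_add, List.map_append, List.flatten_append, ih, List.map_map, e,
      List.replicate_succ', List.flatten_append]
    simp

/-- Every position of an underlying cycle is the beginning of a path in `𝔽` that runs along the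
cycle. -/
theorem IsUnderlyingCycle.exists_minimalZeroPath (hI : IsMonomial I)
    (hG : IsIwanagaGorenstein 1 (BoundQuiverAlgebra I)) {c : QPath V}
    (hc : IsUnderlyingCycle I c) (i : ℕ) :
    ∃ f ∈ minimalZeroPaths I, ∀ j < f.length, f.arrows[j]? = c.arrows[(i + j) % c.length]? := by
  obtain ⟨p, n, hn, s, w, hs, -, hw, ⟨-, l, -, hl⟩, -⟩ := hc
  -- The first `N` factors of the perfect sequence repeated indefinitely; after `k` full turns this
  -- is the power `c ^ (k * l)`.
  let X : ℕ → List (Quiver.Total V) := fun N =>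
    ((List.range N).map fun j => (s (Fin.ofNat n j)).arrows).flatten
  have hXs : ∀ N, X (N + 1) = X N ++ (s (Fin.ofNat n N)).arrows := fun N => by
    simp only [X, List.range_succ, List.map_append, List.flatten_append, List.map_cons,
      List.map_nil, List.flatten_cons, List.flatten_nil, List.append_nil]
  have hXn : ∀ k, X (n * k) = (List.replicate (k * l) c.arrows).flatten := fun k => by
    have h1 := flatten_range_mul (fun i => (s i).arrows) k
    have h2 : (List.ofFn fun i => (s i).arrows).flatten = (List.replicate l c.arrows).flatten := by
      have h3 := hw.arrows_eq
      rw [hl.arrows_eq, List.map_replicate, List.map_ofFn] at h3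
      exact h3.symm
    rw [h2] at h1
    refine h1.trans ?_
    rw [← List.flatten_replicate_replicate, List.flatten_flatten, List.map_replicate]
  have hXlen : ∀ N, (X N).length < (X (N + 1)).length := fun N => by
    rw [hXs, List.length_append]
    exact Nat.lt_add_of_pos_right (hs _).left_nontrivial
  have hXmono : ∀ N M, X N <+: X (N + M) := fun N M => by
    induction M with
    | zero => exact List.prefix_rfl
    | succ M ih => exact ih.trans ⟨_, (hXs (N + M)).symm⟩
  have hXget : ∀ N j, j < (X N).length → (X N)[j]? = c.arrows[j % c.length]? := fun N j hj => by
    have hle : N ≤ n * N := Nat.le_mul_of_pos_left N (Nat.pos_of_ne_zero hn.out)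
    obtain ⟨t, ht⟩ := hXmono N (n * N - N)
    rw [Nat.add_sub_cancel' hle] at ht
    rw [← List.getElem?_append_left (l₂ := t) hj, ht, hXn]
    refine List.getElem?_flatten_replicate _ _ _ ?_
    have h1 := congrArg List.length ht
    have h2 : (List.replicate (N * l) c.arrows).flatten.length = N * l * c.arrows.length := by simp
    rw [List.length_append, hXn, h2] at h1
    omega
  have hlarge : ∃ k, i < (X (k + 1)).length := by
    refine ⟨i, ?_⟩
    have hge : ∀ N, N ≤ (X N).length := fun N => by
      induction N with
      | zero => exact Nat.zero_le _
      | succ N ih => exact lt_of_le_of_lt ih (hXlen N)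
    exact hge (i + 1)
  -- Position `i` lies in the factor with index `k`, at offset `d`.
  obtain ⟨k, hk, hk'⟩ : ∃ k, i < (X (k + 1)).length ∧ (X k).length ≤ i := by
    classical
    refine ⟨Nat.find hlarge, Nat.find_spec hlarge, ?_⟩
    rcases Nat.eq_zero_or_pos (Nat.find hlarge) with h0 | h0
    · rw [h0]
      exact Nat.zero_le _
    · have h1 := Nat.find_min hlarge (Nat.sub_lt h0 one_pos)
      rw [show Nat.find hlarge - 1 + 1 = Nat.find hlarge by omega] at h1
      exact not_lt.1 h1
  obtain ⟨d, rfl⟩ := Nat.exists_eq_add_of_le hk'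
  rw [hXs, List.length_append] at hk
  have hd : d < (s (Fin.ofNat n k)).arrows.length := by omega
  obtain ⟨f, hf, t, ht⟩ := exists_minimalZeroPath_of_consecutive hI hG (hs.pair_ofNat k)
    (hs.pair_ofNat (k + 1)) (List.take_append_drop d (s (Fin.ofNat n k)).arrows).symm
    (List.ne_nil_of_length_pos (by rw [List.length_drop]; omega))
  refine ⟨f, hf, fun j hj => ?_⟩
  have hX3 : X (k + 1 + 1 + 1) =
      (X k ++ (s (Fin.ofNat n k)).arrows.take d) ++ (f.arrows ++ t) := by
    rw [← ht, hXs, hXs, hXs]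
    conv_lhs => rw [← List.take_append_drop d (s (Fin.ofNat n k)).arrows]
    simp only [List.append_assoc]
  have hpre : (X k ++ (s (Fin.ofNat n k)).arrows.take d).length = (X k).length + d := by
    rw [List.length_append, List.length_take, min_eq_left hd.le]
  have hj' : j < f.arrows.length := hj
  rw [← hXget (k + 1 + 1 + 1), hX3, List.getElem?_append_right (by omega), hpre,
    Nat.add_sub_cancel_left, List.getElem?_append_left hj']
  rw [hX3, List.length_append, hpre, List.length_append]
  omega

/-- The entries of `g` sit inside `f` from offset `d` on, so `g` is a zero subpath of the minimal
zero path `f`. -/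
theorem eq_of_mem_of_getElem? (hI : IsMonomial I) {f g : QPath V} (hf : f ∈ minimalZeroPaths I)
    (hg : g ∈ minimalZeroPaths I) {d : ℕ}
    (h : ∀ j < g.length, g.arrows[j]? = f.arrows[d + j]?) : g = f := by
  refine hf.2 g (QPath.isSubpath_of_infix (lt_of_lt_of_le two_pos (hI.two_le_length hg.1)) ?_) hg.1
  have e : g.arrows = (f.arrows.drop d).take g.length := by
    refine List.ext_getElem? fun j => ?_
    rw [List.getElem?_take]
    split_ifs with hj
    · rw [List.getElem?_drop, h j hj]
    · exact List.getElem?_eq_none (not_lt.1 hj)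
  rw [e]
  exact (List.take_prefix _ _).isInfix.trans (List.drop_suffix _ _).isInfix

/-- Co-elementary paths are arrows, so the only possible factorization is the one into arrows. -/
theorem existsUnique_isCoelementaryFactorization [Finite (Quiver.Total V)] (hI : IsMonomial I)
    (hG : IsIwanagaGorenstein 1 (BoundQuiverAlgebra I)) {c : QPath V} (hc : 0 < c.length)
    (ha : ∀ a ∈ c.arrows, IsPerfect I (QPath.ofArrow a)) :
    IsCoelementaryFactorization I c (c.arrows.map QPath.ofArrow) ∧
      ∀ r, IsCoelementaryFactorization I c r → r = c.arrows.map QPath.ofArrow := by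
  refine ⟨⟨fun p hp => ?_, QPath.isConcat_map_ofArrow _ _ _ c.isWalk (List.ne_nil_of_length_pos hc)⟩,
    fun r hr => ?_⟩
  · obtain ⟨a, ha', rfl⟩ := List.mem_map.1 hp
    exact (isCoelementary_iff hI hG).2 ⟨ha a ha', rfl⟩
  · rw [hr.2.arrows_eq]
    exact QPath.eq_map_ofArrow_flatten r fun p hp => ((isCoelementary_iff hI hG).1 (hr.1 p hp)).2

theorem IsUnderlyingCycle.length_pos {c : QPath V} (hc : IsUnderlyingCycle I c) :
    0 < c.length := by
  obtain ⟨p, n, hn, s, w, hs, -, hw, ⟨-, l, -, hl⟩, -⟩ := hc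
  rw [Nat.pos_iff_ne_zero]
  intro h0
  have h1 := hw.arrows_eq
  rw [hl.arrows_eq, List.map_replicate, List.length_eq_zero_iff.1 h0] at h1
  have h2 : ∀ l' ∈ (List.ofFn s).map QPath.arrows, l' = [] :=
    List.flatten_eq_nil_iff.1 (h1.symm.trans (by simp))
  have h3 := h2 (s 0).arrows (List.mem_map.2 ⟨s 0, List.mem_ofFn.2 ⟨0, rfl⟩, rfl⟩)
  exact absurd (hs 0).left_nontrivial (by simp [QPath.length, h3])

end Monomial

/-! ### The proposition -/

theorem mainTheorem8 {K V : Type*} [Field K] [Quiver V] [Fintype V] [Finite (Quiver.Total V)]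
    (I : TwoSidedIdeal (PathAlgebra K V)) (hI : IsMonomial I)
    (hG : IsIwanagaGorenstein 1 (BoundQuiverAlgebra I))
    (c : QPath V) (hc : IsUnderlyingCycle I c) :
    -- every arrow of `c` is perfect
    (∀ a ∈ c.arrows, IsPerfect I (QPath.ofArrow a)) ∧
    -- `c` is uniquely a product of co-elementary paths, and their number `|c|` is `l(c)`
    ((∃! r : List (QPath V), IsCoelementaryFactorization I c r) ∧ cycleSize I c = c.length) ∧
    -- every non-zero non-trivial subpath `p` of a power of `c` with `pq ∈ 𝔽` for some `q` is perfect
    ((∀ (m : ℕ) (w : QPath V), c.IsPower m w →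
        ∀ p : QPath V, p.IsSubpath w → ¬ IsZeroPath I p → 0 < p.length →
          (∃ (q : QPath V) (h : p.tgt = q.src), p.comp q h ∈ minimalZeroPaths I) →
          IsPerfect I p) ∧
    -- for `c = a₁ ⋯ aₙ`, indices modulo `n`, every `aᵢ ⋯ aᵢ₊ₘ` with `m = m_c` belongs to `𝔽`
      (∀ i : ℕ, ∃ w ∈ minimalZeroPaths I, w.length = perfectCount I c + 1 ∧
        ∀ j : ℕ, j ≤ perfectCount I c → w.arrows[j]? = c.arrows[(i + j) % c.length]?)) := by
  have hcl := hc.length_pos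
  choose f hf hfc using hc.exists_minimalZeroPath hI hG
  have hf2 : ∀ i, 2 ≤ (f i).length := fun i => hI.two_le_length (hf i).1
  have hfirst : ∀ i, (f i).arrows[0]? = c.arrows[i % c.length]? := fun i =>
    hfc i 0 (lt_of_lt_of_le two_pos (hf2 i))
  have harrow : ∀ a ∈ c.arrows, IsPerfect I (QPath.ofArrow a) := fun a ha => by
    obtain ⟨i, hi, rfl⟩ := List.getElem_of_mem ha
    have h1 := hfirst i
    rw [Nat.mod_eq_of_lt (show i < c.length from hi), List.getElem?_eq_getElem hi] at h1
    exact isPerfect_ofArrow_of_mem hI hG (hf i) (List.mem_of_getElem? h1)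
  obtain ⟨hfact, huniq⟩ := existsUnique_isCoelementaryFactorization hI hG hcl harrow
  have hfactors : coelementaryFactors I c = c.arrows.map QPath.ofArrow := by
    have hex : ∃ r, IsCoelementaryFactorization I c r := ⟨_, hfact⟩
    rw [coelementaryFactors, dif_pos hex]
    exact huniq _ hex.choose_spec
  refine ⟨harrow, ⟨⟨_, hfact, huniq⟩, ?_⟩, ?_, ?_⟩
  · rw [cycleSize, hfactors, List.length_map]
    rfl
  · intro m w _ p _ hp0 hpl hpq
    exact (isPerfect_iff hI hG).2 ⟨hp0, hpl, hpq⟩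
  · have hsame : ∀ i i', i % c.length = i' % c.length → (f i).length ≤ (f i').length →
        f i = f i' := fun i i' hii hle => by
      refine eq_of_mem_of_getElem? hI (hf i') (hf i) (d := 0) fun j hj => ?_
      rw [hfc i j hj, Nat.zero_add, hfc i' j (lt_of_lt_of_le hj hle), Nat.add_mod, hii,
        ← Nat.add_mod]
    have hper : ∀ i i', i % c.length = i' % c.length → (f i).length = (f i').length :=
      fun i i' hii => by
        rcases le_total (f i).length (f i').length with h | h
        · rw [hsame i i' hii h]
        · rw [hsame i' i hii.symm h]
    -- If `f (i + 1)` were shorter than `f i`, it would end inside it and be a proper zero subpath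
    -- of a member of `𝔽`.
    have hmono : Monotone fun i => (f i).length := monotone_nat_of_le_succ fun i => by
      by_contra! hlt
      have e : f (i + 1) = f i := by
        refine eq_of_mem_of_getElem? hI (hf i) (hf (i + 1)) (d := 1) fun j hj => ?_
        rw [hfc (i + 1) j hj, hfc i (1 + j) (by omega), add_assoc]
      rw [e] at hlt
      exact lt_irrefl _ hlt
    have hconst : ∀ i, (f i).length = (f 0).length := fun i => by
      refine le_antisymm ?_ (hmono (Nat.zero_le i))
      -- A multiple of the period that is at least `i`: monotonicity then bounds the length at `i`
      -- by the length at 0.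
      rw [hper 0 (c.length * i) (by simp)]
      exact hmono (Nat.le_mul_of_pos_left i hcl)
    obtain ⟨a, l, hal⟩ := List.exists_cons_of_length_pos hcl
    obtain ⟨b, t, hbt⟩ := List.exists_cons_of_length_pos (lt_of_lt_of_le two_pos (hf2 0))
    have hab : b = a := by
      have h1 := hfirst 0
      rw [hbt, Nat.zero_mod, hal] at h1
      exact Option.some_injective _ h1
    have hcount : perfectCount I c = (f 0).length - 1 := by
      rw [← ncard_perfect_of_mem hI hG (hf 0) (hab ▸ hbt), perfectCount, hfactors, hal]
      congr 1
      ext p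
      simp
    intro i
    have h2 := hf2 0
    refine ⟨f i, hf i, by rw [hconst i, hcount]; omega, fun j hj => hfc i j ?_⟩
    rw [hconst i]
    omega
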